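/- Let $\alpha,\beta$ be real with $\alpha\beta\neq0$, put $\delta=2\beta^2-9\alpha$, and let $\rho\in\mathbb{C}$ be a square root of $\beta^2-4\alpha$. Assume $\delta\neq0$, $\beta^2\neq3\alpha$ and $\rho\neq0$. Let $I$ be a nonempty open interval and let $g\in C^\infty(I)$ be real-valued without zeros. Put \[A=18g^2+2-9g_y,\qquad B=3g_y+3g^2-1,\qquad l=A^{1/3}\] (all cube roots of real numbers, here and below, are real) and fix antiderivatives $\int g\,dy$ and $\int l^2g^{-1}dy$ on $I$. On $\mathbb{R}\times I$ consider the metric \[ds^2=\exp\Big\{2\Big(x-\int g\,dy\Big)\Big\}(dx^2+dy^2),\] whose geodesic Hamiltonian is $H=\tfrac12\exp\{2(\int g\,dy-x)\}(p_1^2+p_2^2)$. Define \[K_{6}=(3\rho-\beta)\,l\,p_2-2(\delta\beta)^{1/3}(3gp_1+p_2),\qquad K_{7}=(3\rho+\beta)\,l\,p_2+2(\delta\beta)^{1/3}(3gp_1+p_2),\] \[K_8=\beta^{2/3}l\,p_2-\delta^{1/3}(3gp_1+p_2),\qquad K_9=\exp\Big\{2\alpha\rho(\delta\beta)^{-2/3}\int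 l^2g^{-1}dy\Big\},\] \[T=K_6^{\rho+\beta}K_7^{\rho-\beta}K_8^{-2\rho}K_9 ,\] with principal complex powers, on the open dense set where $K_6K_7K_8\neq0$ and, if $\rho$ is not real, $p_2\neq0$. We say that the metric is integrable with the first integral $T$ if $T$ is smooth on this set, $\{T,H\}=0$ there, and $dT$, $dH$ are linearly independent over $\mathbb{C}$ on a dense subset of it. (1) The metric is integrable with the first integral $T$ if and only if \[\beta^2(2\beta^2-9\alpha)^2(gA_y-BA)^3-A^5(\beta^2-3\alpha)^3=0\quad\text{on } I\qquad(*)\] and $A\neq0$ everywhere on $I$. In that case $K_6,K_7,K_8$ are relative Killing vectors and $K_9$ is a relative Killing tensor of degree $0$: $\{H,K_j\}=L_jK_j$, where $L_j$ is linear in the momenta with smooth coefficients. (2) Let in addition $4\alpha=\beta^2(1-r^2)$ with $r\in\mathbb{Q}$, $r\neq0,\pm1,\pm\tfrac13$, and write $r=p/q$ in lowest terms with $q>0$. If $g$ satisfies $(*)$ and $A\neq0$ on $I$, then, with the choice $\rho=\beta r$, the metric is integrable (on the set $K_6K_7K_8\neq0$) with the first integral \[T_r=K_6^{p+q}K_7^{p-q}K_8^{-2p}K_9^{q/\beta},\]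 which is a rational function of the momenta of degree exactly $\max(2|p|,|p|+q)$: a quotient of two real homogeneous polynomials of this degree in $(p_1,p_2)$ with smooth coefficients and without common factors at any base point. (3) The degree is arbitrary: for every integer $n\geq3$ there is a rational $r\neq0,\pm1,\pm\tfrac13$ with $\max(2|p|,|p|+q)=n$ such that for all $\alpha$, $\beta\neq0$ with $4\alpha=\beta^2(1-r^2)$ there are $I$ and $g$ as above that satisfy $(*)$ with $A\neq0$ on $I$. -/

import Mathlib

open scoped ContDiff

noncomputable section

namespace ConformalGeodesic

/-- Points of the cotangent bundle `T*ℝ²`: a base point `(x, y)` followed by a momentum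
`(p₁, p₂)`; index `0` is the `x`-direction and index `1` the `y`-direction. -/
abbrev Phase : Type := (Fin 2 → ℝ) × (Fin 2 → ℝ)

/-- The partial derivative of `F` with respect to the `i`-th base coordinate. -/
def dBase (F : Phase → ℂ) (i : Fin 2) (z : Phase) : ℂ := fderiv ℝ F z (Pi.single i 1, 0)

/-- The partial derivative of `F` with respect to the `i`-th momentum. -/
def dMom (F : Phase → ℂ) (i : Fin 2) (z : Phase) : ℂ := fderiv ℝ F z (0, Pi.single i 1)

/-- The canonical Poisson bracket `{F, E}`. -/
def poisson (F E : Phase → ℂ) (z : Phase) : ℂ :=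
  ∑ i, (dBase F i z * dMom E i z - dMom F i z * dBase E i z)

/-- The Hamiltonian `H = (1/2) gⁱʲ pᵢ pⱼ` of the geodesic flow of the metric `m`. -/
def geodesicHamiltonian (m : (Fin 2 → ℝ) → Matrix (Fin 2) (Fin 2) ℝ) (z : Phase) : ℝ :=
  1 / 2 * ∑ i, ∑ j, (m z.1)⁻¹ i j * z.2 i * z.2 j

/-- The metric `exp (2 (x - G y)) (dx² + dy²)`, where `G` stands for `∫ g dy`. -/
def conformalMetric (G : ℝ → ℝ) (q : Fin 2 → ℝ) : Matrix (Fin 2) (Fin 2) ℝ :=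
  Real.exp (2 * (q 0 - G (q 1))) • (1 : Matrix (Fin 2) (Fin 2) ℝ)

/-- The Hamiltonian of the geodesic flow of `conformalMetric G`. -/
def hamiltonian (G : ℝ → ℝ) : Phase → ℝ := geodesicHamiltonian (conformalMetric G)

theorem hamiltonian_eq (G : ℝ → ℝ) (z : Phase) :
    hamiltonian G z =
      1 / 2 * Real.exp (2 * (G (z.1 1) - z.1 0)) * (z.2 0 ^ 2 + z.2 1 ^ 2) := by
  have h : (conformalMetric G z.1)⁻¹ =
      Real.exp (2 * (G (z.1 1) - z.1 0)) • (1 : Matrix (Fin 2) (Fin 2) ℝ) := by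
    apply Matrix.inv_eq_right_inv
    unfold conformalMetric
    rw [Matrix.smul_mul, Matrix.mul_smul, Matrix.one_mul, smul_smul, ← Real.exp_add]
    have : 2 * (z.1 0 - G (z.1 1)) + 2 * (G (z.1 1) - z.1 0) = 0 := by ring
    rw [this, Real.exp_zero, one_smul]
  unfold hamiltonian geodesicHamiltonian
  rw [h]
  simp [Fin.sum_univ_two]
  ring

/-- `T` is smooth on the (open) set `U`, is a first integral there of the Hamiltonian system with
Hamiltonian `H`, and is functionally independent of `H`: the differentials of `T` and `H` are
linearly independent on a dense subset of `U`. -/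
def IsIntegrableWith (H : Phase → ℝ) (U : Set Phase) (T : Phase → ℂ) : Prop :=
  ContDiffOn ℝ ∞ T U ∧
  (∀ z ∈ U, poisson T (fun w => (H w : ℂ)) z = 0) ∧
  U ⊆ closure {z ∈ U | LinearIndependent ℂ
    ![fderiv ℝ T z, fderiv ℝ (fun w => (H w : ℂ)) z]}

/-- Over the base region `Ω`, `K` is a homogeneous polynomial of degree `d` in the momenta whose
coefficients are smooth functions of the base point. -/
def IsHomogeneousInMomenta (Ω : Set (Fin 2 → ℝ)) (d : ℕ) (K : Phase → ℂ) : Prop :=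
  ∃ P : (Fin 2 → ℝ) → MvPolynomial (Fin 2) ℂ,
    (∀ s, ContDiffOn ℝ ∞ (fun q => (P q).coeff s) Ω) ∧
    ∀ q ∈ Ω, (P q).IsHomogeneous d ∧
      ∀ p : Fin 2 → ℝ, K (q, p) = MvPolynomial.eval (fun i => (p i : ℂ)) (P q)

/-- `K` is a homogeneous relative Killing tensor of degree `d` over the base region `Ω`:
`{H, K} = L K` with a cofactor `L` that is linear in the momenta. -/
def IsRelativeKilling (H : Phase → ℝ) (Ω : Set (Fin 2 → ℝ)) (d : ℕ) (K : Phase → ℂ) : Prop :=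
  IsHomogeneousInMomenta Ω d K ∧
  ∃ L : Phase → ℂ, IsHomogeneousInMomenta Ω 1 L ∧
    ∀ q ∈ Ω, ∀ p : Fin 2 → ℝ,
      poisson (fun w => (H w : ℂ)) K (q, p) = L (q, p) * K (q, p)

/-- Over the base region `Ω`, `T` is a real rational function of the momenta of degree exactly `n`:
a quotient of two real homogeneous polynomials of degree `n` in the momenta, with coefficients
smooth in the base point, that have no common factor over any base point. -/
def IsRationalOfDegree (Ω : Set (Fin 2 → ℝ)) (n : ℕ) (T : Phase → ℂ) : Prop :=
  ∃ N D : (Fin 2 → ℝ) → MvPolynomial (Fin 2) ℝ,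
    (∀ s, ContDiffOn ℝ ∞ (fun q => (N q).coeff s) Ω) ∧
    (∀ s, ContDiffOn ℝ ∞ (fun q => (D q).coeff s) Ω) ∧
    ∀ q ∈ Ω, (N q).IsHomogeneous n ∧ (D q).IsHomogeneous n ∧ IsRelPrime (N q) (D q) ∧
      ∀ p : Fin 2 → ℝ, MvPolynomial.eval p (D q) ≠ 0 →
        T (q, p) = ((MvPolynomial.eval p (N q) / MvPolynomial.eval p (D q) : ℝ) : ℂ)

/-- The real cube root. -/
def cbrt (t : ℝ) : ℝ := (SignType.sign t : ℝ) * |t| ^ (1 / 3 : ℝ)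

theorem cbrt_pow_three (t : ℝ) : cbrt t ^ 3 = t := by
  have h : (|t| ^ (1 / 3 : ℝ)) ^ 3 = |t| := by
    rw [← Real.rpow_natCast, ← Real.rpow_mul (abs_nonneg t)]
    norm_num
  unfold cbrt
  rw [mul_pow, h]
  rcases lt_trichotomy t 0 with ht | ht | ht
  · rw [sign_neg ht, abs_of_neg ht]; norm_num
  · simp [ht]
  · rw [sign_pos ht, abs_of_pos ht]; norm_num

/-- `A = 18 g² + 2 - 9 g_y`. -/
def coefA (g : ℝ → ℝ) (y : ℝ) : ℝ := 18 * g y ^ 2 + 2 - 9 * deriv g y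

/-- `B = 3 g_y + 3 g² - 1`. -/
def coefB (g : ℝ → ℝ) (y : ℝ) : ℝ := 3 * deriv g y + 3 * g y ^ 2 - 1

/-- The real function `l` with `l³ = A`. -/
def coefL (g : ℝ → ℝ) (y : ℝ) : ℝ := cbrt (coefA g y)

/-- `δ = 2 β² - 9 α`. -/
def delta (α β : ℝ) : ℝ := 2 * β ^ 2 - 9 * α

/-- `g` satisfies `β² (2β² - 9α)² (g A_y - B A)³ - A⁵ (β² - 3α)³ = 0` on `I`. -/
def SolvesODE (α β : ℝ) (I : Set ℝ) (g : ℝ → ℝ) : Prop :=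
  ∀ y ∈ I,
    β ^ 2 * (2 * β ^ 2 - 9 * α) ^ 2 *
        (g y * deriv (coefA g) y - coefB g y * coefA g y) ^ 3
      - coefA g y ^ 5 * (β ^ 2 - 3 * α) ^ 3 = 0

/-- `K₆ = (3ρ - β) l p₂ - 2 (δβ)^(1/3) (3 g p₁ + p₂)`. -/
def K₆ (α β : ℝ) (ρ : ℂ) (g : ℝ → ℝ) (z : Phase) : ℂ :=
  (3 * ρ - β) * coefL g (z.1 1) * z.2 1
    - 2 * cbrt (delta α β * β) * (3 * g (z.1 1) * z.2 0 + z.2 1)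

/-- `K₇ = (3ρ + β) l p₂ + 2 (δβ)^(1/3) (3 g p₁ + p₂)`. -/
def K₇ (α β : ℝ) (ρ : ℂ) (g : ℝ → ℝ) (z : Phase) : ℂ :=
  (3 * ρ + β) * coefL g (z.1 1) * z.2 1
    + 2 * cbrt (delta α β * β) * (3 * g (z.1 1) * z.2 0 + z.2 1)

/-- `K₈ = β^(2/3) l p₂ - δ^(1/3) (3 g p₁ + p₂)`. -/
def K₈ (α β : ℝ) (g : ℝ → ℝ) (z : Phase) : ℂ :=
  (cbrt β : ℂ) ^ 2 * coefL g (z.1 1) * z.2 1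
    - cbrt (delta α β) * (3 * g (z.1 1) * z.2 0 + z.2 1)

/-- `K₉ = exp (2 α ρ (δβ)^(-2/3) ∫ l² g⁻¹ dy)`, where `Q` stands for `∫ l² g⁻¹ dy`. -/
def K₉ (α β : ℝ) (ρ : ℂ) (Q : ℝ → ℝ) (z : Phase) : ℂ :=
  Complex.exp (2 * α * ρ * ((cbrt (delta α β * β) : ℂ) ^ 2)⁻¹ * Q (z.1 1))

/-- `T = K₆^(ρ+β) K₇^(ρ-β) K₈^(-2ρ) K₉`, with principal complex powers. -/
def integralT (α β : ℝ) (ρ : ℂ) (g Q : ℝ → ℝ) (z : Phase) : ℂ :=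
  K₆ α β ρ g z ^ (ρ + β) * K₇ α β ρ g z ^ (ρ - β) * K₈ α β g z ^ (-2 * ρ) * K₉ α β ρ Q z

/-- `T_r = K₆^(p+q) K₇^(p-q) K₈^(-2p) K₉^(q/β)` for `r = p/q` in lowest terms, `q > 0`,
where `ρ = β r`. -/
def integralTr (α β : ℝ) (r : ℚ) (g Q : ℝ → ℝ) (z : Phase) : ℂ :=
  K₆ α β (β * r) g z ^ (r.num + r.den : ℤ) * K₇ α β (β * r) g z ^ (r.num - r.den : ℤ)
    * K₈ α β g z ^ (-2 * r.num : ℤ) * K₉ α β (β * r) Q z ^ ((r.den : ℂ) / β)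

/-- The common degree of numerator and denominator of `T_r`. -/
def degTr (r : ℚ) : ℕ := max (2 * r.num.natAbs) (r.num.natAbs + r.den)

/-- The part of the base on which the metric is considered. -/
def baseRegion (I : Set ℝ) : Set (Fin 2 → ℝ) := {q | q 1 ∈ I}

/-- The open dense part of the phase space on which `K₆`, `K₇`, `K₈` do not vanish. For
non-real `ρ` also the hyperplane `p₂ = 0` is removed: away from it the values of `K₆` and `K₇`
do not cross the branch cut of the principal powers. -/
def regularRegion (α β : ℝ) (ρ : ℂ) (I : Set ℝ) (g : ℝ → ℝ) : Set Phase :=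
  {z | z.1 ∈ baseRegion I ∧ K₆ α β ρ g z ≠ 0 ∧ K₇ α β ρ g z ≠ 0 ∧ K₈ α β g z ≠ 0 ∧
    (ρ.im = 0 ∨ z.2 1 ≠ 0)}

/-- `I` is a nonempty open interval, `g` is smooth and without zeros on `I`, and `G` and `Q` are
antiderivatives of `g` and of `l² / g` on `I`. -/
def IsSetting (I : Set ℝ) (g G Q : ℝ → ℝ) : Prop :=
  IsOpen I ∧ IsConnected I ∧ ContDiffOn ℝ ∞ g I ∧ (∀ y ∈ I, g y ≠ 0) ∧
  (∀ y ∈ I, HasDerivAt G (g y) y) ∧ (∀ y ∈ I, HasDerivAt Q (coefL g y ^ 2 / g y) y)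

/-- `r` is admissible: `r ≠ 0, ±1, ±1/3`. -/
def IsAdmissible (r : ℚ) : Prop :=
  r ≠ 0 ∧ r ≠ 1 ∧ r ≠ -1 ∧ r ≠ 1 / 3 ∧ r ≠ -(1 / 3)

end ConformalGeodesic

end

open ConformalGeodesic

open scoped ContDiff

noncomputable section

namespace ConformalGeodesic

open Filter Topology

/-! ### The real cube root -/

/-! Put X = 3 g p₁ + p₂, Y = l p₂, m = (δβ)^(1/3) and k = (β² - 3α)/m². Up to constants, K₆, K₇, K₈
are the forms X + t Y for the three roots t of t³ - 3kt - 1; their product is Π = X³ - 3kXY² + Y³.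
The exponents n = ρ+β, ρ-β, -2ρ satisfy Σ n = Σ n t = 0 (`isFactorization`), so by partial fractions
Σ n d log(X + tY) collapses to S Y (Y dX - X dY)/Π with S = Σ n t² ≠ 0. The factor K₉ supplies a dy
term, and d log T = S · `logForm`, where `logForm` is real and does not involve ρ. On the
Hamiltonian field the relation l³ = A reduces `logForm` to p₂² X Y/(3gΠ) times a function of y alone
(`logForm_hamVec`). Where A ≠ 0, this function vanishes exactly when g A_y - B A = k A l², which is
(*) after taking real cube roots (`cube_ode_iff`).

Sufficiency follows at once; dT and dH are independent wherever p₂ ≠ 0. Conversely, a vanishing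
bracket gives the reduced equation only where A ≠ 0. If A vanished on an open set, then Y = 0 there
and, since Σ n = 0, dT would vanish; so A ≠ 0 on a dense set and the equation extends by continuity.
It is linear in A with continuous coefficient (B + k l²)/g, so a single zero of A would force A to
vanish identically.

For ρ = βr the power q/β makes all exponents integers. They sum to zero and the three linear forms
are pairwise non-proportional, which gives the degree and the coprimality. Solutions exist because
the definition of A and the reduced equation form a smooth first-order system for (g, A) where both
are positive. -/

theorem pow_three_injective : Function.Injective fun t : ℝ => t ^ 3 :=
  (Odd.strictMono_pow (by decide)).injective

theorem cbrt_eq_of_pow_eq {s t : ℝ} (h : s ^ 3 = t) : cbrt t = s :=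
  pow_three_injective (by simpa [h] using cbrt_pow_three t)

theorem cbrt_mul (s t : ℝ) : cbrt (s * t) = cbrt s * cbrt t :=
  cbrt_eq_of_pow_eq (by rw [mul_pow, cbrt_pow_three, cbrt_pow_three])

theorem cbrt_ne_zero {t : ℝ} (h : t ≠ 0) : cbrt t ≠ 0 := fun h0 =>
  h (by rw [← cbrt_pow_three t, h0]; norm_num)

theorem cbrt_zero : cbrt 0 = 0 := by simp [cbrt]

theorem cbrt_neg (t : ℝ) : cbrt (-t) = -cbrt t :=
  cbrt_eq_of_pow_eq (by rw [Odd.neg_pow (by decide), cbrt_pow_three])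

theorem continuous_cbrt : Continuous cbrt := by
  have hm : StrictMono cbrt := fun s t h => by
    by_contra! hc
    have := (Odd.strictMono_pow (n := 3) (R := ℝ) (by decide)).monotone hc
    simp only [cbrt_pow_three] at this
    linarith
  exact hm.monotone.continuous_of_surjective fun s => ⟨s ^ 3, cbrt_eq_of_pow_eq rfl⟩

theorem contDiffAt_cbrt {t : ℝ} (h : t ≠ 0) : ContDiffAt ℝ ∞ cbrt t := by
  have hpos : ∀ s : ℝ, 0 < s → ContDiffAt ℝ ∞ cbrt s := fun s hs => by
    refine (Real.contDiffAt_rpow_const_of_ne (p := 1 / 3) hs.ne').congr_of_eventuallyEq ?_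
    filter_upwards [lt_mem_nhds hs] with u hu
    simp [cbrt, sign_pos hu, abs_of_pos hu]
  rcases lt_or_gt_of_ne h with hn | hp
  · have h1 : ContDiffAt ℝ ∞ (fun s => -cbrt (-s)) t :=
      ((hpos (-t) (by linarith)).comp t contDiff_neg.contDiffAt).neg
    simpa [cbrt_neg] using h1
  · exact hpos t hp

/-- Differentiability is known away from zero, so the value can be read off by differentiating the
cube of the root. -/
theorem hasDerivAt_cbrt_comp {f : ℝ → ℝ} {f' y : ℝ} (hf : HasDerivAt f f' y) (h0 : f y ≠ 0) :
    HasDerivAt (fun s => cbrt (f s)) (f' / (3 * cbrt (f y) ^ 2)) y := by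
  have hc := cbrt_ne_zero h0
  obtain ⟨d, hd⟩ : ∃ d, HasDerivAt (fun s => cbrt (f s)) d y :=
    ⟨_, (((contDiffAt_cbrt h0).differentiableAt (by simp)).comp y hf.differentiableAt).hasDerivAt⟩
  have h3 := hd.pow 3
  have : (fun s => cbrt (f s)) ^ 3 = f := by ext s; simp [cbrt_pow_three]
  rw [this] at h3
  have := h3.unique hf
  convert hd using 1
  rw [← this]
  push_cast
  field_simp

/-! ### Antiderivatives and linear equations on open intervals -/

theorem exists_antideriv {I : Set ℝ} (ho : IsOpen I) (hI : IsConnected I) {φ : ℝ → ℝ}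
    (hφ : ContinuousOn φ I) : ∃ Φ : ℝ → ℝ, ∀ y ∈ I, HasDerivAt Φ (φ y) y := by
  obtain ⟨a, ha⟩ := hI.nonempty
  have hord := hI.isPreconnected.ordConnected
  refine ⟨fun y => ∫ s in a..y, φ s, fun y hy => ?_⟩
  have hsub : Set.uIcc a y ⊆ I := hord.uIcc_subset ha hy
  exact intervalIntegral.integral_hasDerivAt_right (hφ.mono hsub).intervalIntegrable
    (hφ.stronglyMeasurableAtFilter ho y hy) (hφ.continuousAt (ho.mem_nhds hy))

/-- The integrating factor exp(-∫φ) makes the product constant on the interval. -/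
theorem eq_zero_of_linear_ode {I : Set ℝ} (ho : IsOpen I) (hI : IsConnected I) {A φ : ℝ → ℝ}
    (hφ : ContinuousOn φ I) (hA : ∀ y ∈ I, HasDerivAt A (φ y * A y) y) {y₀ : ℝ} (hy₀ : y₀ ∈ I)
    (h0 : A y₀ = 0) : ∀ y ∈ I, A y = 0 := by
  obtain ⟨Φ, hΦ⟩ := exists_antideriv ho hI hφ
  have hd : ∀ y ∈ I, HasDerivAt (fun s => A s * Real.exp (-Φ s)) 0 y := fun y hy => by
    refine ((hA y hy).mul (hΦ y hy).neg.exp).congr_deriv ?_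
    ring
  intro y hy
  have hc := ho.is_const_of_deriv_eq_zero hI.isPreconnected
    (fun s hs => (hd s hs).differentiableAt.differentiableWithinAt)
    (fun s hs => (hd s hs).deriv) hy hy₀
  simpa [h0, Real.exp_ne_zero] using hc

/-! ### Regularity of the coefficients -/

section Coefficients
variable {I : Set ℝ} {g : ℝ → ℝ}

theorem contDiffOn_deriv_of_isOpen (ho : IsOpen I) {f : ℝ → ℝ} (hf : ContDiffOn ℝ ∞ f I) :
    ContDiffOn ℝ ∞ (deriv f) I :=
  ((contDiffOn_infty_iff_deriv_of_isOpen ho).1 hf).2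

theorem contDiffOn_coefA (ho : IsOpen I) (hg : ContDiffOn ℝ ∞ g I) :
    ContDiffOn ℝ ∞ (coefA g) I := by
  have := contDiffOn_deriv_of_isOpen ho hg
  unfold coefA
  fun_prop

theorem contDiffOn_coefB (ho : IsOpen I) (hg : ContDiffOn ℝ ∞ g I) :
    ContDiffOn ℝ ∞ (coefB g) I := by
  have := contDiffOn_deriv_of_isOpen ho hg
  unfold coefB
  fun_prop

theorem contDiffOn_coefL (ho : IsOpen I) (hg : ContDiffOn ℝ ∞ g I)
    (hA : ∀ y ∈ I, coefA g y ≠ 0) : ContDiffOn ℝ ∞ (coefL g) I := fun y hy =>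
  ((contDiffAt_cbrt (hA y hy)).comp y
    ((contDiffOn_coefA ho hg).contDiffAt (ho.mem_nhds hy))).contDiffWithinAt

theorem hasDerivAt_of_contDiffOn (ho : IsOpen I) {f : ℝ → ℝ} (hf : ContDiffOn ℝ ∞ f I) {y : ℝ}
    (hy : y ∈ I) : HasDerivAt f (deriv f y) y :=
  ((hf.contDiffAt (ho.mem_nhds hy)).differentiableAt (by simp)).hasDerivAt

theorem coefL_pow_three (g : ℝ → ℝ) (y : ℝ) : coefL g y ^ 3 = coefA g y := cbrt_pow_three _

end Coefficients

/-- The constant `(β² - 3α) / (δβ)^(2/3)` of the cubic `t³ - 3 k t - 1`. -/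
def cubicCoef (α β : ℝ) : ℝ := (β ^ 2 - 3 * α) / cbrt (delta α β * β) ^ 2

/-- Since m⁶ = β²δ² and a⁵ = (a l²)³, the left side compares the cubes of c m² and (β² - 3α) a l²,
and cubing is injective on the reals. -/
theorem cube_ode_iff {α β a c l : ℝ} (hβ : β ≠ 0) (hδ : delta α β ≠ 0) (hl : l ^ 3 = a) :
    β ^ 2 * (2 * β ^ 2 - 9 * α) ^ 2 * c ^ 3 - a ^ 5 * (β ^ 2 - 3 * α) ^ 3 = 0 ↔
      c = cubicCoef α β * a * l ^ 2 := by
  have hm : cbrt (delta α β * β) ≠ 0 := cbrt_ne_zero (mul_ne_zero hδ hβ)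
  have h3 : cbrt (delta α β * β) ^ 3 = delta α β * β := cbrt_pow_three _
  have h6 : cbrt (delta α β * β) ^ 6 = β ^ 2 * (2 * β ^ 2 - 9 * α) ^ 2 := by
    rw [show (6 : ℕ) = 3 * 2 from rfl, pow_mul, h3, delta]; ring
  unfold cubicCoef
  set m := cbrt (delta α β * β)
  rw [← h6, ← hl, div_mul_eq_mul_div, div_mul_eq_mul_div, eq_div_iff (pow_ne_zero 2 hm),
    ← (show Odd 3 by decide).pow_inj (a := c * m ^ 2), sub_eq_zero]
  constructor <;> intro h <;> linear_combination h

/-! ### Logarithmic derivatives -/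

/-- `D` is the logarithmic differential of `F` at `z`: `dF = F D`. -/
def HasLogFDerivAt (F : Phase → ℂ) (D : Phase →L[ℝ] ℂ) (z : Phase) : Prop :=
  HasFDerivAt F (F z • D) z

/-- `F` does not vanish at `z` and principal powers of `F` have no jump near `z`, because the
value `F z` is off the branch cut or because `F` is real near `z`. -/
def IsBranchPoint (F : Phase → ℂ) (z : Phase) : Prop :=
  F z ≠ 0 ∧ (F z ∈ Complex.slitPlane ∨ ∀ᶠ w in 𝓝 z, (F w).im = 0)

section LogDeriv
variable {F E : Phase → ℂ} {D D' : Phase →L[ℝ] ℂ} {z : Phase}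

theorem HasLogFDerivAt.mul (hF : HasLogFDerivAt F D z) (hE : HasLogFDerivAt E D' z) :
    HasLogFDerivAt (fun w => F w * E w) (D + D') z := by
  refine (HasFDerivAt.fun_mul hF hE).congr_fderiv ?_
  ext v <;> simp <;> ring

theorem HasLogFDerivAt.zpow (hF : HasLogFDerivAt F D z) (h0 : F z ≠ 0) (n : ℤ) :
    HasLogFDerivAt (fun w => F w ^ n) ((n : ℂ) • D) z := by
  refine ((hasDerivAt_zpow n (F z) (Or.inl h0)).comp_hasFDerivAt z hF).congr_fderiv ?_
  rw [smul_smul, smul_smul, zpow_sub_one₀ h0]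
  congr 1
  field_simp

theorem hasLogFDerivAt_of_smul {K K₀ : Phase → ℂ} {K₀' : Phase →L[ℝ] ℂ} {c : ℂ}
    (h : ∀ w, K w = c * K₀ w) (h0 : K₀ z ≠ 0) (hK : HasFDerivAt K₀ K₀' z) :
    HasLogFDerivAt K ((K₀ z)⁻¹ • K₀') z := by
  have hK' : K = fun w => c * K₀ w := funext h
  rw [HasLogFDerivAt, hK']
  refine (hK.const_mul c).congr_fderiv ?_
  rw [smul_smul]
  congr 1
  field_simp

theorem hasLogFDerivAt_cexp (hF : HasFDerivAt F D z) :
    HasLogFDerivAt (fun w => Complex.exp (F w)) D z := hF.cexp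

/-- On the negative axis a principal power jumps only in directions leaving the real line. If F
stays real, F^c equals (-F)^c times the constant exp(πic), and -F lies in the slit plane. Hence s =
±1 suffices, and both differentiation and smoothness reduce to the slit plane. -/
theorem IsBranchPoint.exists_cpow_eq (h : IsBranchPoint F z) (hF : ContinuousAt F z) (c : ℂ) :
    ∃ s e : ℂ, s ≠ 0 ∧ s * F z ∈ Complex.slitPlane ∧
      (fun w => F w ^ c) =ᶠ[𝓝 z] fun w => (s * F w) ^ c * e := by
  by_cases hs : F z ∈ Complex.slitPlane
  · exact ⟨1, 1, one_ne_zero, by simpa using hs, by simp⟩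
  · have hreal := h.2.resolve_left hs
    have him : (F z).im = 0 := hreal.self_of_nhds
    have hre : (F z).re < 0 := by
      rw [Complex.mem_slitPlane_iff, not_or, not_lt] at hs
      exact lt_of_le_of_ne hs.1 fun h0 => h.1 (Complex.ext h0 him)
    refine ⟨-1, Complex.exp (Real.pi * Complex.I * c), by norm_num,
      Complex.mem_slitPlane_iff.2 (Or.inl (by simpa using hre)), ?_⟩
    have hlt : ∀ᶠ w in 𝓝 z, (F w).re < 0 :=
      (Complex.continuous_re.continuousAt.comp hF).eventually (gt_mem_nhds hre)
    filter_upwards [hreal, hlt] with w h1 h2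
    have hw : F w = ((F w).re : ℂ) := Complex.ext (by simp) (by simp [h1])
    rw [hw, Complex.ofReal_cpow_of_nonpos h2.le, neg_one_mul]

theorem HasLogFDerivAt.cpow (hF : HasLogFDerivAt F D z) (h : IsBranchPoint F z) (c : ℂ) :
    HasLogFDerivAt (fun w => F w ^ c) (c • D) z := by
  obtain ⟨s, e, hs0, hs, he⟩ := h.exists_cpow_eq (HasFDerivAt.continuousAt hF) c
  have h1 : HasDerivAt (fun u : ℂ => (s * u) ^ c * e)
      (c * (s * F z) ^ (c - 1) * (s * 1) * e) (F z) :=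
    (((hasDerivAt_id (F z)).const_mul s).cpow_const (c := c) hs).mul_const e
  refine ((h1.comp_hasFDerivAt z hF).congr_of_eventuallyEq he).congr_fderiv ?_
  have h0 := mul_ne_zero hs0 h.1
  rw [smul_smul, smul_smul, he.self_of_nhds, Complex.cpow_sub _ _ h0, Complex.cpow_one]
  congr 1
  have := h.1
  field_simp

theorem IsBranchPoint.contDiffAt_cpow (h : IsBranchPoint F z) (hF : ContDiffAt ℝ ∞ F z) (c : ℂ) :
    ContDiffAt ℝ ∞ (fun w => F w ^ c) z := by
  obtain ⟨s, e, hs0, hs, he⟩ := h.exists_cpow_eq hF.continuousAt c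
  refine ContDiffAt.congr_of_eventuallyEq ?_ he
  have h1 : ContDiffAt ℝ ∞ (fun w => Complex.exp (Complex.log (s * F w) * c) * e) z := by
    have hl : ContDiffAt ℝ ∞ (fun w => Complex.log (s * F w)) z :=
      ((Complex.contDiffAt_log hs).restrict_scalars ℝ).comp (f := fun w => s * F w) z
        (contDiffAt_const.mul hF)
    exact ((hl.mul contDiffAt_const).cexp).mul contDiffAt_const
  refine h1.congr_of_eventuallyEq ?_
  have hne : ∀ᶠ w in 𝓝 z, F w ≠ 0 := hF.continuousAt.eventually_ne h.1
  filter_upwards [hne] with w hw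
  rw [Complex.cpow_def_of_ne_zero (mul_ne_zero hs0 hw)]

theorem contDiffAt_zpow_comp (h0 : F z ≠ 0) (hF : ContDiffAt ℝ ∞ F z) (n : ℤ) :
    ContDiffAt ℝ ∞ (fun w => F w ^ n) z := by
  rcases n with n | n
  · simpa using hF.pow n
  · simp only [zpow_negSucc]
    exact (hF.pow (n + 1)).inv (pow_ne_zero _ h0)

end LogDeriv

/-! ### The linear forms on the phase space -/

/-- The differential of the `i`-th base coordinate. -/
def baseCovec (i : Fin 2) : Phase →L[ℝ] ℝ :=
  (ContinuousLinearMap.proj i).comp (ContinuousLinearMap.fst ℝ _ _)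

/-- The differential of the `i`-th momentum. -/
def momCovec (i : Fin 2) : Phase →L[ℝ] ℝ :=
  (ContinuousLinearMap.proj i).comp (ContinuousLinearMap.snd ℝ _ _)

@[simp] theorem baseCovec_apply (i : Fin 2) (v : Phase) : baseCovec i v = v.1 i := rfl
@[simp] theorem momCovec_apply (i : Fin 2) (v : Phase) : momCovec i v = v.2 i := rfl

/-- The form `X = 3 g p₁ + p₂`. -/
def formX (g : ℝ → ℝ) (z : Phase) : ℝ := 3 * g (z.1 1) * z.2 0 + z.2 1

/-- The form `Y = l p₂`. -/
def formY (l : ℝ → ℝ) (z : Phase) : ℝ := l (z.1 1) * z.2 1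

/-- The differential of `X`. -/
def dFormX (g₀ g₁ : ℝ) (z : Phase) : Phase →L[ℝ] ℝ :=
  (3 * g₁ * z.2 0) • baseCovec 1 + (3 * g₀) • momCovec 0 + momCovec 1

/-- The differential of `Y`. -/
def dFormY (l₀ l₁ : ℝ) (z : Phase) : Phase →L[ℝ] ℝ :=
  (l₁ * z.2 1) • baseCovec 1 + l₀ • momCovec 1

theorem hasFDerivAt_comp_base {f : ℝ → ℝ} {f' : ℝ} {z : Phase} (i : Fin 2)
    (hf : HasDerivAt f f' (z.1 i)) : HasFDerivAt (fun w : Phase => f (w.1 i)) (f' • baseCovec i) z :=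
  hf.comp_hasFDerivAt z (baseCovec i).hasFDerivAt

theorem hasFDerivAt_mom (i : Fin 2) (z : Phase) :
    HasFDerivAt (fun w : Phase => w.2 i) (momCovec i) z := (momCovec i).hasFDerivAt

theorem hasFDerivAt_formX {g : ℝ → ℝ} {g₁ : ℝ} {z : Phase} (hg : HasDerivAt g g₁ (z.1 1)) :
    HasFDerivAt (formX g) (dFormX (g (z.1 1)) g₁ z) z := by
  refine ((((hasFDerivAt_comp_base 1 hg).const_mul 3).mul (hasFDerivAt_mom 0 z)).add
    (hasFDerivAt_mom 1 z)).congr_fderiv ?_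
  refine ContinuousLinearMap.ext fun v => ?_
  simp [dFormX]; ring

theorem hasFDerivAt_formY {l : ℝ → ℝ} {l₁ : ℝ} {z : Phase} (hl : HasDerivAt l l₁ (z.1 1)) :
    HasFDerivAt (formY l) (dFormY (l (z.1 1)) l₁ z) z := by
  refine ((hasFDerivAt_comp_base 1 hl).mul (hasFDerivAt_mom 1 z)).congr_fderiv ?_
  refine ContinuousLinearMap.ext fun v => ?_
  simp [dFormY]; ring

theorem hasFDerivAt_ofReal_comp {f : Phase → ℝ} {D : Phase →L[ℝ] ℝ} {z : Phase}
    (hf : HasFDerivAt f D z) :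
    HasFDerivAt (fun w => (f w : ℂ)) (Complex.ofRealCLM.comp D) z :=
  Complex.ofRealCLM.hasFDerivAt.comp z hf

theorem contDiffAt_comp_base {f : ℝ → ℝ} {z : Phase} (hf : ContDiffAt ℝ ∞ f (z.1 1)) :
    ContDiffAt ℝ ∞ (fun w : Phase => f (w.1 1)) z :=
  hf.comp (f := fun w : Phase => w.1 1) z (baseCovec 1).contDiff.contDiffAt

theorem contDiffAt_formX {g : ℝ → ℝ} {z : Phase} (hg : ContDiffAt ℝ ∞ g (z.1 1)) :
    ContDiffAt ℝ ∞ (formX g) z :=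
  ((contDiffAt_const.mul (contDiffAt_comp_base hg)).mul (momCovec 0).contDiff.contDiffAt).add
    (momCovec 1).contDiff.contDiffAt

theorem contDiffAt_formY {l : ℝ → ℝ} {z : Phase} (hl : ContDiffAt ℝ ∞ l (z.1 1)) :
    ContDiffAt ℝ ∞ (formY l) z :=
  (contDiffAt_comp_base hl).mul (momCovec 1).contDiff.contDiffAt

/-- The linear form `X + t Y` in the momenta. -/
def linForm (t : ℂ) (l g : ℝ → ℝ) (z : Phase) : ℂ := formX g z + t * formY l z

theorem hasFDerivAt_linForm {l g : ℝ → ℝ} {l₁ g₁ : ℝ} {z : Phase} (t : ℂ)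
    (hl : HasDerivAt l l₁ (z.1 1)) (hg : HasDerivAt g g₁ (z.1 1)) :
    HasFDerivAt (linForm t l g) (Complex.ofRealCLM.comp (dFormX (g (z.1 1)) g₁ z)
      + t • Complex.ofRealCLM.comp (dFormY (l (z.1 1)) l₁ z)) z :=
  (hasFDerivAt_ofReal_comp (hasFDerivAt_formX hg)).add
    ((hasFDerivAt_ofReal_comp (hasFDerivAt_formY hl)).const_mul t)

theorem contDiffAt_linForm {l g : ℝ → ℝ} {z : Phase} (t : ℂ)
    (hl : ContDiffAt ℝ ∞ l (z.1 1)) (hg : ContDiffAt ℝ ∞ g (z.1 1)) :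
    ContDiffAt ℝ ∞ (linForm t l g) z :=
  (Complex.ofRealCLM.contDiff.contDiffAt.comp z (contDiffAt_formX hg)).add
    (contDiffAt_const.mul (Complex.ofRealCLM.contDiff.contDiffAt.comp z (contDiffAt_formY hl)))

/-! ### The Hamiltonian -/

section Hamiltonian
variable {G : ℝ → ℝ} {g₀ : ℝ} {z : Phase}

/-- The conformal factor `exp (2 (∫ g dy - x))` of the Hamiltonian. -/
def conformalFactor (G : ℝ → ℝ) (q : Fin 2 → ℝ) : ℝ := Real.exp (2 * (G (q 1) - q 0))

theorem conformalFactor_pos (G : ℝ → ℝ) (q : Fin 2 → ℝ) : 0 < conformalFactor G q :=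
  Real.exp_pos _

/-- The differential of the Hamiltonian. -/
def dHamiltonian (G : ℝ → ℝ) (g₀ : ℝ) (z : Phase) : Phase →L[ℝ] ℝ :=
  conformalFactor G z.1 • ((z.2 0 ^ 2 + z.2 1 ^ 2) • (g₀ • baseCovec 1 - baseCovec 0)
    + z.2 0 • momCovec 0 + z.2 1 • momCovec 1)

theorem hasFDerivAt_hamiltonian (hG : HasDerivAt G g₀ (z.1 1)) :
    HasFDerivAt (hamiltonian G) (dHamiltonian G g₀ z) z := by
  have h : hamiltonian G = fun w : Phase =>
      1 / 2 * Real.exp (2 * (G (w.1 1) - w.1 0)) * (w.2 0 ^ 2 + w.2 1 ^ 2) :=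
    funext (hamiltonian_eq G)
  rw [h]
  have hx : HasFDerivAt (fun w : Phase => w.1 0) (baseCovec 0) z := (baseCovec 0).hasFDerivAt
  refine ((((((hasFDerivAt_comp_base 1 hG).sub hx).const_mul 2).exp).const_mul (1 / 2)).mul
    (((hasFDerivAt_mom 0 z).pow 2).add ((hasFDerivAt_mom 1 z).pow 2))).congr_fderiv ?_
  ext v <;> simp [dHamiltonian, conformalFactor] <;> ring

/-- The Hamiltonian vector field, up to the conformal factor. -/
def hamVec (g₀ : ℝ) (z : Phase) : Phase :=
  (![z.2 0, z.2 1], ![z.2 0 ^ 2 + z.2 1 ^ 2, -(g₀ * (z.2 0 ^ 2 + z.2 1 ^ 2))])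

theorem fderiv_eq_sum {F : Phase → ℂ} (v : Phase) :
    fderiv ℝ F z v = ∑ i, (v.1 i * dBase F i z + v.2 i * dMom F i z) := by
  have hv : v = ∑ i, (v.1 i • ((Pi.single i 1, 0) : Phase) + v.2 i • (0, Pi.single i 1)) := by
    refine Prod.ext (funext fun i => ?_) (funext fun i => ?_) <;> fin_cases i <;>
      simp [Fin.sum_univ_two]
  conv_lhs => rw [hv]
  simp only [map_sum, map_add, map_smul, Complex.real_smul, dBase, dMom]

theorem poisson_hamiltonian (hG : HasDerivAt G g₀ (z.1 1)) (F : Phase → ℂ) :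
    poisson F (fun w => (hamiltonian G w : ℂ)) z =
      conformalFactor G z.1 * fderiv ℝ F z (hamVec g₀ z) := by
  have hH := (hasFDerivAt_ofReal_comp (hasFDerivAt_hamiltonian hG)).fderiv
  rw [fderiv_eq_sum]
  simp only [poisson, Fin.sum_univ_two]
  simp [dMom, dBase, hH, dHamiltonian, hamVec]
  ring

theorem poisson_antisymm (F E : Phase → ℂ) (z : Phase) : poisson F E z = -poisson E F z := by
  simp only [poisson, Fin.sum_univ_two]; ring

end Hamiltonian

/-! ### The logarithmic differential of the integral -/

/-- The cubic form `X³ - 3 k X Y² + Y³`. -/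
def cubicForm (k X Y : ℝ) : ℝ := X ^ 3 - 3 * k * X * Y ^ 2 + Y ^ 3

/-- The real one-form `Y (Y dX - X dY) / Π - l² / (9 g) dy`, where `Π = X³ - 3 k X Y² + Y³`; the
logarithmic differential of the integral is a constant multiple of it. -/
def logForm (k : ℝ) (l g : ℝ → ℝ) (l₁ g₁ : ℝ) (z : Phase) : Phase →L[ℝ] ℝ :=
  (formY l z / cubicForm k (formX g z) (formY l z)) •
      (formY l z • dFormX (g (z.1 1)) g₁ z - formX g z • dFormY (l (z.1 1)) l₁ z)
    - (l (z.1 1) ^ 2 / (9 * g (z.1 1))) • baseCovec 1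

section Core
variable {k : ℝ} {l g G : ℝ → ℝ} {l₁ g₁ : ℝ} {z : Phase}

/-- This is where A comes from: on the line X = 0 the numerator of the contraction equals l² p₂⁴
(18g² + 2 - 9g' - l³). Thus l³ = A makes X a factor, and the coefficient 1/9 of the dy term cancels
the X³ contribution. -/
theorem logForm_hamVec (hg : g (z.1 1) ≠ 0) (hC : cubicForm k (formX g z) (formY l z) ≠ 0)
    (hA : l (z.1 1) ^ 3 = 18 * g (z.1 1) ^ 2 + 2 - 9 * g₁) :
    logForm k l g l₁ g₁ z (hamVec (g (z.1 1)) z) =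
      z.2 1 ^ 2 * formX g z * formY l z
          * (k * l (z.1 1) ^ 3 + l (z.1 1) * (3 * g₁ + 3 * g (z.1 1) ^ 2 - 1)
            - 3 * g (z.1 1) * l₁)
        / (3 * g (z.1 1) * cubicForm k (formX g z) (formY l z)) := by
  have h : 9 * g (z.1 1) * (formY l z * (formY l z * (3 * g₁ * z.2 0 * z.2 1
        + 2 * g (z.1 1) * (z.2 0 ^ 2 + z.2 1 ^ 2))
      - formX g z * (l₁ * z.2 1 ^ 2 - g (z.1 1) * l (z.1 1) * (z.2 0 ^ 2 + z.2 1 ^ 2))))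
      - l (z.1 1) ^ 2 * z.2 1 * cubicForm k (formX g z) (formY l z) =
      3 * (z.2 1 ^ 2 * formX g z * formY l z
          * (k * l (z.1 1) ^ 3 + l (z.1 1) * (3 * g₁ + 3 * g (z.1 1) ^ 2 - 1)
            - 3 * g (z.1 1) * l₁)) := by
    simp only [cubicForm, formX, formY]
    linear_combination -(l (z.1 1) ^ 2 * z.2 1 ^ 4) * hA
  rw [eq_div_iff (mul_ne_zero (mul_ne_zero three_ne_zero hg) hC)]
  simp only [logForm, dFormX, dFormY, hamVec, sub_apply,
    add_apply, smul_apply, baseCovec_apply,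
    momCovec_apply, smul_eq_mul, Matrix.cons_val_zero, Matrix.cons_val_one]
  field_simp
  linear_combination 3 * h

theorem logForm_baseX : logForm k l g l₁ g₁ z (Pi.single 0 1, 0) = 0 := by
  simp [logForm, dFormX, dFormY]

theorem logForm_momX : logForm k l g l₁ g₁ z (0, Pi.single 0 1) =
    3 * g (z.1 1) * formY l z ^ 2 / cubicForm k (formX g z) (formY l z) := by
  simp [logForm, dFormX, dFormY]
  ring

variable {T : Phase → ℂ} {S : ℂ}

theorem poisson_of_logForm (hG : HasDerivAt G (g (z.1 1)) (z.1 1))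
    (hT : HasLogFDerivAt T (S • Complex.ofRealCLM.comp (logForm k l g l₁ g₁ z)) z) :
    poisson T (fun w => (hamiltonian G w : ℂ)) z = conformalFactor G z.1 *
      (T z * (S * (logForm k l g l₁ g₁ z (hamVec (g (z.1 1)) z) : ℝ))) := by
  rw [poisson_hamiltonian hG, HasFDerivAt.fderiv hT]
  simp

/-- The vector ∂/∂x annihilates dT but not dH, because H is proportional to exp(-2x). The vector
∂/∂p₁ then detects dT, whose value there is a multiple of Y². -/
theorem linearIndependent_of_logForm (hG : HasDerivAt G (g (z.1 1)) (z.1 1))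
    (hT : HasLogFDerivAt T (S • Complex.ofRealCLM.comp (logForm k l g l₁ g₁ z)) z)
    (hT0 : T z ≠ 0) (hS : S ≠ 0) (hg : g (z.1 1) ≠ 0) (hl : l (z.1 1) ≠ 0)
    (hC : cubicForm k (formX g z) (formY l z) ≠ 0) (hp : z.2 1 ≠ 0) :
    LinearIndependent ℂ ![fderiv ℝ T z, fderiv ℝ (fun w => (hamiltonian G w : ℂ)) z] := by
  rw [HasFDerivAt.fderiv hT, (hasFDerivAt_ofReal_comp (hasFDerivAt_hamiltonian hG)).fderiv,
    LinearIndependent.pair_iff]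
  intro a b hab
  have hsq : (0 : ℝ) < z.2 0 ^ 2 + z.2 1 ^ 2 := by positivity
  have hb : b = 0 := by
    have h := DFunLike.congr_fun hab (Pi.single 0 1, 0)
    have hv : dHamiltonian G (g (z.1 1)) z (Pi.single 0 1, 0) ≠ 0 := by
      rw [show dHamiltonian G (g (z.1 1)) z (Pi.single 0 1, 0) =
        -(conformalFactor G z.1 * (z.2 0 ^ 2 + z.2 1 ^ 2)) by simp [dHamiltonian]; ring]
      exact neg_ne_zero.2 (mul_ne_zero (conformalFactor_pos G z.1).ne' hsq.ne')
    simpa [logForm_baseX, hv] using h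
  refine ⟨?_, hb⟩
  have h := DFunLike.congr_fun hab (0, Pi.single 0 1)
  have hY : formY l z ≠ 0 := mul_ne_zero hl hp
  simpa [logForm_momX, hb, hT0, hS, hg, hC, hY] using h

end Core

/-! ### Sums over the three linear forms -/

section ThreeForms
variable {n₁ n₂ n₃ t₁ t₂ t₃ S X Y : ℂ}

/-- Over the common denominator the numerator is quadratic in X and Y, with coefficients that are
combinations of the moments Σ n, Σ n t, Σ n t²; only the last survives. -/
theorem sum_div_three_forms (h0 : n₁ + n₂ + n₃ = 0) (h1 : n₁ * t₁ + n₂ * t₂ + n₃ * t₃ = 0)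
    (h2 : n₁ * t₁ ^ 2 + n₂ * t₂ ^ 2 + n₃ * t₃ ^ 2 = S)
    (ha : X + t₁ * Y ≠ 0) (hb : X + t₂ * Y ≠ 0) (hc : X + t₃ * Y ≠ 0) :
    n₁ * (X + t₁ * Y)⁻¹ + n₂ * (X + t₂ * Y)⁻¹ + n₃ * (X + t₃ * Y)⁻¹ =
      S * Y ^ 2 / ((X + t₁ * Y) * (X + t₂ * Y) * (X + t₃ * Y)) := by
  rw [eq_div_iff (mul_ne_zero (mul_ne_zero ha hb) hc)]
  generalize hu : X + t₁ * Y = u at *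
  generalize hv : X + t₂ * Y = v at *
  generalize hw : X + t₃ * Y = w at *
  field_simp
  subst hu hv hw
  linear_combination (X ^ 2 + (t₁ + t₂ + t₃) * X * Y
    + (t₁ * t₂ + t₁ * t₃ + t₂ * t₃) * Y ^ 2) * h0
    - (X * Y + (t₁ + t₂ + t₃) * Y ^ 2) * h1 + Y ^ 2 * h2

theorem sum_mul_div_three_forms (h0 : n₁ + n₂ + n₃ = 0)
    (h1 : n₁ * t₁ + n₂ * t₂ + n₃ * t₃ = 0)
    (h2 : n₁ * t₁ ^ 2 + n₂ * t₂ ^ 2 + n₃ * t₃ ^ 2 = S)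
    (ha : X + t₁ * Y ≠ 0) (hb : X + t₂ * Y ≠ 0) (hc : X + t₃ * Y ≠ 0) :
    n₁ * t₁ * (X + t₁ * Y)⁻¹ + n₂ * t₂ * (X + t₂ * Y)⁻¹ + n₃ * t₃ * (X + t₃ * Y)⁻¹ =
      -(S * X * Y / ((X + t₁ * Y) * (X + t₂ * Y) * (X + t₃ * Y))) := by
  rw [← neg_div, eq_div_iff (mul_ne_zero (mul_ne_zero ha hb) hc)]
  generalize hu : X + t₁ * Y = u at *
  generalize hv : X + t₂ * Y = v at *
  generalize hw : X + t₃ * Y = w at *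
  field_simp
  subst hu hv hw
  linear_combination (X ^ 2 + (t₁ + t₂ + t₃) * X * Y) * h1
    - X * Y * h2 + t₁ * t₂ * t₃ * Y ^ 2 * h0

end ThreeForms

/-- The roots `-t` of `X + t Y` in the cubic form, and the moments of the exponents. -/
structure IsFactorization (k : ℝ) (t n : Fin 3 → ℂ) (S : ℂ) : Prop where
  sum_root : t 0 + t 1 + t 2 = 0
  sum_root_mul : t 0 * t 1 + t 0 * t 2 + t 1 * t 2 = -3 * k
  root_mul : t 0 * t 1 * t 2 = 1
  sum_exp : n 0 + n 1 + n 2 = 0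
  sum_exp_mul : n 0 * t 0 + n 1 * t 1 + n 2 * t 2 = 0
  sum_exp_sq : n 0 * t 0 ^ 2 + n 1 * t 1 ^ 2 + n 2 * t 2 ^ 2 = S

namespace IsFactorization
variable {k : ℝ} {t n : Fin 3 → ℂ} {S : ℂ} {l g : ℝ → ℝ} {l₁ g₁ : ℝ} {z : Phase}

theorem prod_linForm (h : IsFactorization k t n S) (l g : ℝ → ℝ) (z : Phase) :
    linForm (t 0) l g z * linForm (t 1) l g z * linForm (t 2) l g z =
      (cubicForm k (formX g z) (formY l z) : ℝ) := by
  simp only [linForm, cubicForm]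
  push_cast
  linear_combination (formX g z : ℂ) ^ 2 * formY l z * h.sum_root
    + (formX g z : ℂ) * formY l z ^ 2 * h.sum_root_mul + (formY l z : ℂ) ^ 3 * h.root_mul

theorem cubicForm_ne_zero (h : IsFactorization k t n S)
    (h0 : ∀ i, linForm (t i) l g z ≠ 0) : cubicForm k (formX g z) (formY l z) ≠ 0 := by
  have := h.prod_linForm l g z
  intro hc
  rw [hc, Complex.ofReal_zero] at this
  exact mul_ne_zero (mul_ne_zero (h0 0) (h0 1)) (h0 2) this

theorem sum_logFDeriv (h : IsFactorization k t n S) (h0 : ∀ i, linForm (t i) l g z ≠ 0) :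
    n 0 • ((linForm (t 0) l g z)⁻¹ • (Complex.ofRealCLM.comp (dFormX (g (z.1 1)) g₁ z)
        + t 0 • Complex.ofRealCLM.comp (dFormY (l (z.1 1)) l₁ z)))
      + n 1 • ((linForm (t 1) l g z)⁻¹ • (Complex.ofRealCLM.comp (dFormX (g (z.1 1)) g₁ z)
        + t 1 • Complex.ofRealCLM.comp (dFormY (l (z.1 1)) l₁ z)))
      + n 2 • ((linForm (t 2) l g z)⁻¹ • (Complex.ofRealCLM.comp (dFormX (g (z.1 1)) g₁ z)
        + t 2 • Complex.ofRealCLM.comp (dFormY (l (z.1 1)) l₁ z)))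
      + (-S / 9 * ((l (z.1 1) ^ 2 / g (z.1 1) : ℝ) : ℂ)) • Complex.ofRealCLM.comp (baseCovec 1)
      = S • Complex.ofRealCLM.comp (logForm k l g l₁ g₁ z) := by
  have hs := sum_div_three_forms h.sum_exp h.sum_exp_mul h.sum_exp_sq (h0 0) (h0 1) (h0 2)
  have hs' := sum_mul_div_three_forms h.sum_exp h.sum_exp_mul h.sum_exp_sq (h0 0) (h0 1) (h0 2)
  have hp := h.prod_linForm l g z
  simp only [linForm] at hp
  rw [hp] at hs hs'
  refine ContinuousLinearMap.ext fun v => ?_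
  simp only [logForm, add_apply, sub_apply,
    smul_apply, ContinuousLinearMap.comp_apply, Complex.ofRealCLM_apply,
    smul_eq_mul, linForm]
  push_cast
  linear_combination (dFormX (g (z.1 1)) g₁ z v : ℂ) * hs
    + (dFormY (l (z.1 1)) l₁ z v : ℂ) * hs'

end IsFactorization

/-! ### Factorization of `K₆`, `K₇`, `K₈` -/

/-- The numbers `t` with `K` proportional to `X + t Y`, for `K = K₆, K₇, K₈`. -/
def formRoot (α β : ℝ) (ρ : ℂ) : Fin 3 → ℂ :=
  ![(β - 3 * ρ) / (2 * cbrt (delta α β * β)), (3 * ρ + β) / (2 * cbrt (delta α β * β)),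
    -β / cbrt (delta α β * β)]

/-- The exponents of `K₆, K₇, K₈`, up to the common factor `ν`. -/
def formExp (β : ℝ) (ρ ν : ℂ) : Fin 3 → ℂ := ![ν * (ρ + β), ν * (ρ - β), ν * (-2 * ρ)]

/-- The second moment of `formRoot` with respect to `formExp`. -/
def secondMoment (α β : ℝ) (ρ ν : ℂ) : ℂ :=
  -18 * ν * α * ρ * ((cbrt (delta α β * β) : ℂ) ^ 2)⁻¹

section Factor
variable {α β : ℝ} {ρ : ℂ}

theorem cbrt_delta_mul_ne_zero (hβ : β ≠ 0) (hδ : delta α β ≠ 0) :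
    (cbrt (delta α β * β) : ℂ) ≠ 0 := by
  exact_mod_cast cbrt_ne_zero (mul_ne_zero hδ hβ)

theorem isFactorization (hβ : β ≠ 0) (hδ : delta α β ≠ 0)
    (hρ : ρ ^ 2 = ((β ^ 2 - 4 * α : ℝ) : ℂ)) (ν : ℂ) :
    IsFactorization (cubicCoef α β) (formRoot α β ρ) (formExp β ρ ν) (secondMoment α β ρ ν) := by
  have hm := cbrt_delta_mul_ne_zero hβ hδ
  have hm3 : (cbrt (delta α β * β) : ℂ) ^ 3 = (2 * β ^ 2 - 9 * α) * β := by
    exact_mod_cast cbrt_pow_three (delta α β * β)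
  push_cast at hρ
  constructor <;>
    simp only [formRoot, formExp, secondMoment, cubicCoef, Matrix.cons_val_zero,
      Matrix.cons_val_one, Matrix.cons_val] <;> push_cast <;>
    generalize (cbrt (delta α β * β) : ℂ) = m at * <;> field_simp
  · ring
  · linear_combination -9 * hρ
  · linear_combination -4 * hm3 + 9 * β * hρ
  · ring
  · ring
  · linear_combination (18 * ν * ρ) * hρ

theorem K₆_eq (hβ : β ≠ 0) (hδ : delta α β ≠ 0) (ρ : ℂ) (g : ℝ → ℝ) (z : Phase) :
    K₆ α β ρ g z = -2 * cbrt (delta α β * β) * linForm (formRoot α β ρ 0) (coefL g) g z := by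
  have hm := cbrt_delta_mul_ne_zero hβ hδ
  simp only [K₆, linForm, formRoot, formX, formY, Matrix.cons_val_zero]
  push_cast
  field_simp
  ring

theorem K₇_eq (hβ : β ≠ 0) (hδ : delta α β ≠ 0) (ρ : ℂ) (g : ℝ → ℝ) (z : Phase) :
    K₇ α β ρ g z = 2 * cbrt (delta α β * β) * linForm (formRoot α β ρ 1) (coefL g) g z := by
  have hm := cbrt_delta_mul_ne_zero hβ hδ
  simp only [K₇, linForm, formRoot, formX, formY, Matrix.cons_val_one]
  push_cast
  field_simp
  ring

theorem K₈_eq (hβ : β ≠ 0) (hδ : delta α β ≠ 0) (ρ : ℂ) (g : ℝ → ℝ) (z : Phase) :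
    K₈ α β g z = -cbrt (delta α β) * linForm (formRoot α β ρ 2) (coefL g) g z := by
  have hb : (cbrt β : ℂ) ^ 3 = β := by exact_mod_cast cbrt_pow_three β
  have hb0 : (cbrt β : ℂ) ≠ 0 := by exact_mod_cast cbrt_ne_zero hβ
  have hd0 : (cbrt (delta α β) : ℂ) ≠ 0 := by exact_mod_cast cbrt_ne_zero hδ
  simp only [K₈, linForm, formRoot, formX, formY, Matrix.cons_val, cbrt_mul]
  push_cast
  field_simp
  linear_combination (coefL g (z.1 1) * z.2 1 : ℂ) * hb

/-- The linear forms `X + t Y` attached to `K₆, K₇, K₈` do not vanish at `z`. -/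
theorem linForm_ne_zero {g : ℝ → ℝ} {z : Phase} (hβ : β ≠ 0) (hδ : delta α β ≠ 0)
    (h6 : K₆ α β ρ g z ≠ 0) (h7 : K₇ α β ρ g z ≠ 0) (h8 : K₈ α β g z ≠ 0) (i : Fin 3) :
    linForm (formRoot α β ρ i) (coefL g) g z ≠ 0 := by
  rw [K₆_eq hβ hδ] at h6
  rw [K₇_eq hβ hδ] at h7
  rw [K₈_eq hβ hδ ρ] at h8
  fin_cases i
  exacts [right_ne_zero_of_mul h6, right_ne_zero_of_mul h7, right_ne_zero_of_mul h8]

theorem K_ne_zero_of_linForm {g : ℝ → ℝ} {z : Phase} (hβ : β ≠ 0) (hδ : delta α β ≠ 0)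
    (h : ∀ i, linForm (formRoot α β ρ i) (coefL g) g z ≠ 0) :
    K₆ α β ρ g z ≠ 0 ∧ K₇ α β ρ g z ≠ 0 ∧ K₈ α β g z ≠ 0 := by
  have hm := cbrt_delta_mul_ne_zero hβ hδ
  have hd0 : (cbrt (delta α β) : ℂ) ≠ 0 := by exact_mod_cast cbrt_ne_zero hδ
  rw [K₆_eq hβ hδ, K₇_eq hβ hδ, K₈_eq hβ hδ ρ]
  exact ⟨mul_ne_zero (mul_ne_zero (by norm_num) hm) (h 0),
    mul_ne_zero (mul_ne_zero two_ne_zero hm) (h 1), mul_ne_zero (neg_ne_zero.2 hd0) (h 2)⟩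

theorem K₆_im (ρ : ℂ) (g : ℝ → ℝ) (z : Phase) :
    (K₆ α β ρ g z).im = 3 * ρ.im * (coefL g (z.1 1) * z.2 1) := by
  simp [K₆]; ring

theorem K₇_im (ρ : ℂ) (g : ℝ → ℝ) (z : Phase) :
    (K₇ α β ρ g z).im = 3 * ρ.im * (coefL g (z.1 1) * z.2 1) := by
  simp [K₇]; ring

theorem K₈_im (g : ℝ → ℝ) (z : Phase) : (K₈ α β g z).im = 0 := by
  simp [K₈, ← Complex.ofReal_pow]

/-- For non-real ρ the form is off the real axis when l p₂ ≠ 0. The case of l vanishing near the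
base point, where the form is again real, serves to exclude A = 0 on an open set. -/
theorem isBranchPoint_of_im {K : Phase → ℂ} {g : ℝ → ℝ} {z : Phase} (h0 : K z ≠ 0)
    (him : ∀ w, (K w).im = 3 * ρ.im * (coefL g (w.1 1) * w.2 1))
    (h : ρ.im = 0 ∨ coefL g (z.1 1) * z.2 1 ≠ 0 ∨ ∀ᶠ y in 𝓝 (z.1 1), coefL g y = 0) :
    IsBranchPoint K z := by
  refine ⟨h0, ?_⟩
  by_cases hi : ρ.im = 0
  · exact Or.inr (Eventually.of_forall fun w => by simp [him, hi])
  rcases h.resolve_left hi with h | h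
  · refine Or.inl (Complex.mem_slitPlane_iff.2 (Or.inr ?_))
    rw [him]
    exact mul_ne_zero (mul_ne_zero three_ne_zero hi) h
  · refine Or.inr ?_
    have hc : ContinuousAt (fun w : Phase => w.1 1) z := (baseCovec 1).continuous.continuousAt
    filter_upwards [hc.eventually h] with w hw
    rw [him, hw, zero_mul, mul_zero]

/-! ### Logarithmic differentials of the integrals -/

variable {g Q : ℝ → ℝ} {g₁ l₁ : ℝ} {z : Phase}

theorem hasLogFDerivAt_K₉ (ρ : ℂ) {Q' : ℝ} (hQ : HasDerivAt Q Q' (z.1 1)) (ν : ℂ) :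
    HasLogFDerivAt (fun w => Complex.exp
        (2 * α * (ν * ρ) * ((cbrt (delta α β * β) : ℂ) ^ 2)⁻¹ * Q (w.1 1)))
      ((-secondMoment α β ρ ν / 9 * (Q' : ℂ)) • Complex.ofRealCLM.comp (baseCovec 1)) z := by
  refine hasLogFDerivAt_cexp (((hasFDerivAt_ofReal_comp
    (hasFDerivAt_comp_base 1 hQ)).const_mul _).congr_fderiv ?_)
  refine ContinuousLinearMap.ext fun v => ?_
  simp only [secondMoment, smul_apply, ContinuousLinearMap.comp_apply,
    Complex.ofRealCLM_apply, smul_eq_mul]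
  push_cast
  ring

theorem hasLogFDerivAt_integralT (hβ : β ≠ 0) (hδ : delta α β ≠ 0)
    (hρ : ρ ^ 2 = ((β ^ 2 - 4 * α : ℝ) : ℂ))
    (hg : HasDerivAt g g₁ (z.1 1)) (hl : HasDerivAt (coefL g) l₁ (z.1 1))
    (hQ : HasDerivAt Q (coefL g (z.1 1) ^ 2 / g (z.1 1)) (z.1 1))
    (h6 : IsBranchPoint (K₆ α β ρ g) z) (h7 : IsBranchPoint (K₇ α β ρ g) z)
    (h8 : K₈ α β g z ≠ 0) :
    HasLogFDerivAt (integralT α β ρ g Q) (secondMoment α β ρ 1 •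
      Complex.ofRealCLM.comp (logForm (cubicCoef α β) (coefL g) g l₁ g₁ z)) z := by
  have h0 := linForm_ne_zero hβ hδ h6.1 h7.1 h8
  have h8' : IsBranchPoint (K₈ α β g) z := ⟨h8, Or.inr (Eventually.of_forall (K₈_im g))⟩
  have d := fun i => hasFDerivAt_linForm (formRoot α β ρ i) hl hg
  have e6 := (hasLogFDerivAt_of_smul (K₆_eq hβ hδ ρ g) (h0 0) (d 0)).cpow h6 (ρ + β)
  have e7 := (hasLogFDerivAt_of_smul (K₇_eq hβ hδ ρ g) (h0 1) (d 1)).cpow h7 (ρ - β)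
  have e8 := (hasLogFDerivAt_of_smul (K₈_eq hβ hδ ρ g) (h0 2) (d 2)).cpow h8' (-2 * ρ)
  have e9 := hasLogFDerivAt_K₉ (α := α) (β := β) ρ hQ 1
  have hT := ((e6.mul e7).mul e8).mul e9
  have hsum := (isFactorization hβ hδ hρ 1).sum_logFDeriv (l₁ := l₁) (g₁ := g₁) h0
  simp only [formExp, Matrix.cons_val_zero, Matrix.cons_val_one, Matrix.cons_val, one_mul] at hsum
  rw [hsum] at hT
  simp only [one_mul] at hT
  exact hT

theorem K₉_cpow (r : ℚ) (z : Phase) :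
    K₉ α β (β * r) Q z ^ ((r.den : ℂ) / β) = Complex.exp (2 * α * ((r.den / β) * (β * r)) *
      ((cbrt (delta α β * β) : ℂ) ^ 2)⁻¹ * Q (z.1 1)) := by
  -- The exponent is real, so the principal logarithm inverts the exponential and the complex power
  -- merely rescales the exponent.
  have him : (2 * α * (β * r) * ((cbrt (delta α β * β) : ℂ) ^ 2)⁻¹ * Q (z.1 1)).im = 0 := by
    have : (2 * α * (β * r) * ((cbrt (delta α β * β) : ℂ) ^ 2)⁻¹ * Q (z.1 1)) =
      ((2 * α * (β * r) * (cbrt (delta α β * β) ^ 2)⁻¹ * Q (z.1 1) : ℝ) : ℂ) := by push_cast; rfl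
    rw [this, Complex.ofReal_im]
  rw [K₉, Complex.cpow_def_of_ne_zero (Complex.exp_ne_zero _), Complex.log_exp
    (by rw [him]; exact neg_lt_zero.2 Real.pi_pos) (by rw [him]; exact Real.pi_pos.le)]
  congr 1
  ring

theorem integralTr_eq (r : ℚ) : integralTr α β r g Q = fun z =>
    K₆ α β (β * r) g z ^ (r.num + r.den : ℤ) * K₇ α β (β * r) g z ^ (r.num - r.den : ℤ)
      * K₈ α β g z ^ (-2 * r.num : ℤ) * Complex.exp (2 * α * ((r.den / β) * (β * r)) *
      ((cbrt (delta α β * β) : ℂ) ^ 2)⁻¹ * Q (z.1 1)) := by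
  funext z
  rw [integralTr, K₉_cpow]

theorem hasLogFDerivAt_integralTr {r : ℚ} (hβ : β ≠ 0) (hδ : delta α β ≠ 0)
    (hρ : ((β : ℂ) * r) ^ 2 = ((β ^ 2 - 4 * α : ℝ) : ℂ))
    (hg : HasDerivAt g g₁ (z.1 1)) (hl : HasDerivAt (coefL g) l₁ (z.1 1))
    (hQ : HasDerivAt Q (coefL g (z.1 1) ^ 2 / g (z.1 1)) (z.1 1))
    (h6 : K₆ α β (β * r) g z ≠ 0) (h7 : K₇ α β (β * r) g z ≠ 0)
    (h8 : K₈ α β g z ≠ 0) :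
    HasLogFDerivAt (integralTr α β r g Q) (secondMoment α β (β * r) (r.den / β) •
      Complex.ofRealCLM.comp (logForm (cubicCoef α β) (coefL g) g l₁ g₁ z)) z := by
  have h0 := linForm_ne_zero hβ hδ h6 h7 h8
  have d := fun i => hasFDerivAt_linForm (formRoot α β (β * r) i) hl hg
  have e6 := (hasLogFDerivAt_of_smul (K₆_eq hβ hδ _ g) (h0 0) (d 0)).zpow h6 (r.num + r.den : ℤ)
  have e7 := (hasLogFDerivAt_of_smul (K₇_eq hβ hδ _ g) (h0 1) (d 1)).zpow h7 (r.num - r.den : ℤ)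
  have e8 := (hasLogFDerivAt_of_smul (K₈_eq hβ hδ _ g) (h0 2) (d 2)).zpow h8 (-2 * r.num : ℤ)
  have e9 := hasLogFDerivAt_K₉ (α := α) (β := β) (β * r : ℂ) hQ (r.den / β)
  have hT := ((e6.mul e7).mul e8).mul e9
  have hsum := (isFactorization hβ hδ hρ (r.den / β)).sum_logFDeriv (l₁ := l₁) (g₁ := g₁) h0
  have hβ' : (β : ℂ) ≠ 0 := by exact_mod_cast hβ
  have hr : (r : ℂ) * r.den = r.num := by exact_mod_cast Rat.mul_den_eq_num r
  -- The common factor ν = q/β turns the exponents β(r ± 1) and -2βr into p ± q and -2p.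
  have x6 : (r.den / β : ℂ) * (β * r + β) = ((r.num + r.den : ℤ) : ℂ) := by
    field_simp; push_cast; linear_combination hr
  have x7 : (r.den / β : ℂ) * (β * r - β) = ((r.num - r.den : ℤ) : ℂ) := by
    field_simp; push_cast; linear_combination hr
  have x8 : (r.den / β : ℂ) * (-2 * (β * r)) = ((-2 * r.num : ℤ) : ℂ) := by
    field_simp; push_cast; linear_combination (-2 : ℂ) * hr
  simp only [formExp, Matrix.cons_val_zero, Matrix.cons_val_one, Matrix.cons_val, x6, x7, x8]
    at hsum
  rw [hsum] at hT
  rw [HasLogFDerivAt, integralTr_eq]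
  exact hT

end Factor

/-! ### Sufficiency of the differential equation -/

section Integrability
variable {α β : ℝ} {ρ : ℂ} {I : Set ℝ} {g G Q : ℝ → ℝ}

theorem secondMoment_ne_zero (hα : α ≠ 0) (hβ : β ≠ 0) (hδ : delta α β ≠ 0) (hρ : ρ ≠ 0) {ν : ℂ}
    (hν : ν ≠ 0) : secondMoment α β ρ ν ≠ 0 := by
  have hm := cbrt_delta_mul_ne_zero hβ hδ
  have hα' : (α : ℂ) ≠ 0 := by exact_mod_cast hα
  simp [secondMoment, hα', hρ, hm, hν]

/-- The reduced form `g A' - B A = k A l²` of the differential equation. -/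
theorem solvesODE_iff (hβ : β ≠ 0) (hδ : delta α β ≠ 0) :
    SolvesODE α β I g ↔ ∀ y ∈ I, g y * deriv (coefA g) y - coefB g y * coefA g y =
      cubicCoef α β * coefA g y * coefL g y ^ 2 :=
  forall₂_congr fun y _ => cube_ode_iff hβ hδ (coefL_pow_three g y)

theorem IsSetting.hasDerivAt_coefA (h : IsSetting I g G Q) {y : ℝ} (hy : y ∈ I) :
    HasDerivAt (coefA g) (deriv (coefA g) y) y :=
  hasDerivAt_of_contDiffOn h.1 (contDiffOn_coefA h.1 h.2.2.1) hy

theorem IsSetting.hasDerivAt_g (h : IsSetting I g G Q) {y : ℝ} (hy : y ∈ I) :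
    HasDerivAt g (deriv g y) y :=
  hasDerivAt_of_contDiffOn h.1 h.2.2.1 hy

theorem IsSetting.hasDerivAt_coefL (h : IsSetting I g G Q) {y : ℝ} (hy : y ∈ I)
    (hA : coefA g y ≠ 0) :
    HasDerivAt (coefL g) (deriv (coefA g) y / (3 * coefL g y ^ 2)) y :=
  hasDerivAt_cbrt_comp (h.hasDerivAt_coefA hy) hA

theorem coefL_ne_zero {y : ℝ} (hA : coefA g y ≠ 0) : coefL g y ≠ 0 := cbrt_ne_zero hA

theorem defect_eq_zero_iff (k : ℝ) {y : ℝ} (hA : coefA g y ≠ 0) :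
    k * coefL g y ^ 3 + coefL g y * (3 * deriv g y + 3 * g y ^ 2 - 1)
        - 3 * g y * (deriv (coefA g) y / (3 * coefL g y ^ 2)) = 0 ↔
      g y * deriv (coefA g) y - coefB g y * coefA g y = k * coefA g y * coefL g y ^ 2 := by
  have hl := coefL_ne_zero hA
  rw [← coefL_pow_three, coefB, ← mul_left_inj' (pow_ne_zero 2 hl), zero_mul]
  have : (k * coefL g y ^ 3 + coefL g y * (3 * deriv g y + 3 * g y ^ 2 - 1)
        - 3 * g y * (deriv (coefA g) y / (3 * coefL g y ^ 2))) * coefL g y ^ 2 =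
      k * coefL g y ^ 5 + coefL g y ^ 3 * (3 * deriv g y + 3 * g y ^ 2 - 1)
        - g y * deriv (coefA g) y := by
    field_simp
  rw [this]
  constructor <;> intro h <;> linear_combination -h

theorem contDiffAt_K {z : Phase} (h : IsSetting I g G Q) (hβ : β ≠ 0) (hδ : delta α β ≠ 0)
    (hz : z.1 1 ∈ I) (hA : coefA g (z.1 1) ≠ 0) (ρ : ℂ) :
    ContDiffAt ℝ ∞ (K₆ α β ρ g) z ∧ ContDiffAt ℝ ∞ (K₇ α β ρ g) z ∧
      ContDiffAt ℝ ∞ (K₈ α β g) z := by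
  have hg := h.2.2.1.contDiffAt (h.1.mem_nhds hz)
  have hl : ContDiffAt ℝ ∞ (coefL g) (z.1 1) := (contDiffAt_cbrt hA).comp _
    ((contDiffOn_coefA h.1 h.2.2.1).contDiffAt (h.1.mem_nhds hz))
  rw [funext (K₆_eq hβ hδ ρ g), funext (K₇_eq hβ hδ ρ g), funext (K₈_eq hβ hδ ρ g)]
  exact ⟨contDiffAt_const.mul (contDiffAt_linForm _ hl hg),
    contDiffAt_const.mul (contDiffAt_linForm _ hl hg),
    contDiffAt_const.mul (contDiffAt_linForm _ hl hg)⟩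

theorem IsSetting.contDiffOn_Q (h : IsSetting I g G Q) (hA : ∀ y ∈ I, coefA g y ≠ 0) :
    ContDiffOn ℝ ∞ Q I := by
  rw [contDiffOn_infty_iff_deriv_of_isOpen h.1]
  refine ⟨fun y hy => (h.2.2.2.2.2 y hy).differentiableAt.differentiableWithinAt, ?_⟩
  exact (((contDiffOn_coefL h.1 h.2.2.1 hA).pow 2).div h.2.2.1 h.2.2.2.1).congr
    fun y hy => (h.2.2.2.2.2 y hy).deriv

theorem contDiffAt_exp_Q {z : Phase} (h : IsSetting I g G Q) (hA : ∀ y ∈ I, coefA g y ≠ 0)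
    (hz : z.1 1 ∈ I) (c : ℂ) : ContDiffAt ℝ ∞ (fun w => Complex.exp (c * Q (w.1 1))) z :=
  (contDiffAt_const.mul (Complex.ofRealCLM.contDiff.contDiffAt.comp z
    (contDiffAt_comp_base ((h.contDiffOn_Q hA).contDiffAt (h.1.mem_nhds hz))))).cexp

/-- A point of the region with p₂ = 0 occurs only for real ρ; moving p₂ slightly then stays in the
region, since the K's vary continuously along the momentum fibre. -/
theorem regularRegion_subset_closure (α β : ℝ) (ρ : ℂ) (I : Set ℝ) (g : ℝ → ℝ) :
    regularRegion α β ρ I g ⊆ closure {z ∈ regularRegion α β ρ I g | z.2 1 ≠ 0} := by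
  intro z hz
  by_cases hp : z.2 1 ≠ 0
  · exact subset_closure ⟨hz, hp⟩
  rw [not_not] at hp
  have hρ : ρ.im = 0 := hz.2.2.2.2.resolve_right (fun h => h hp)
  let γ : ℝ → Phase := fun ε => (z.1, ![z.2 0, ε])
  have hγ0 : γ 0 = z := Prod.ext rfl (funext fun i => by fin_cases i <;> simp [γ, hp])
  have hγ : Continuous γ := by
    refine continuous_const.prodMk (continuous_pi fun i => ?_)
    fin_cases i
    · exact continuous_const
    · exact continuous_id
  have h6 : Continuous fun ε => K₆ α β ρ g (γ ε) := by
    simp only [K₆, γ, Matrix.cons_val_zero, Matrix.cons_val_one]; fun_prop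
  have h7 : Continuous fun ε => K₇ α β ρ g (γ ε) := by
    simp only [K₇, γ, Matrix.cons_val_zero, Matrix.cons_val_one]; fun_prop
  have h8 : Continuous fun ε => K₈ α β g (γ ε) := by
    simp only [K₈, γ, Matrix.cons_val_zero, Matrix.cons_val_one]; fun_prop
  have ht : Tendsto γ (𝓝[≠] 0) (𝓝 z) := by
    have := (hγ.tendsto 0).mono_left (nhdsWithin_le_nhds (s := {0}ᶜ))
    rwa [hγ0] at this
  refine mem_closure_of_tendsto ht ?_
  filter_upwards [self_mem_nhdsWithin,
    nhdsWithin_le_nhds (h6.continuousAt.eventually_ne (x := 0) (by rw [hγ0]; exact hz.2.1)),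
    nhdsWithin_le_nhds (h7.continuousAt.eventually_ne (x := 0) (by rw [hγ0]; exact hz.2.2.1)),
    nhdsWithin_le_nhds (h8.continuousAt.eventually_ne (x := 0) (by rw [hγ0]; exact hz.2.2.2.1))]
    with ε hε e6 e7 e8
  exact ⟨⟨hz.1, e6, e7, e8, Or.inl hρ⟩, hε⟩

theorem isIntegrableWith_of_logForm {T : Phase → ℂ} {S : ℂ} (h : IsSetting I g G Q)
    (hβ : β ≠ 0) (hδ : delta α β ≠ 0) (hρ : ρ ^ 2 = ((β ^ 2 - 4 * α : ℝ) : ℂ))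
    (hode : SolvesODE α β I g) (hA : ∀ y ∈ I, coefA g y ≠ 0) (hS : S ≠ 0)
    (hT : ∀ z ∈ regularRegion α β ρ I g, ContDiffAt ℝ ∞ T z ∧ T z ≠ 0 ∧
      HasLogFDerivAt T (S • Complex.ofRealCLM.comp (logForm (cubicCoef α β) (coefL g) g
        (deriv (coefA g) (z.1 1) / (3 * coefL g (z.1 1) ^ 2)) (deriv g (z.1 1)) z)) z) :
    IsIntegrableWith (hamiltonian G) (regularRegion α β ρ I g) T := by
  have hC : ∀ z ∈ regularRegion α β ρ I g,
      cubicForm (cubicCoef α β) (formX g z) (formY (coefL g) z) ≠ 0 := fun z hz =>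
    (isFactorization hβ hδ hρ 1).cubicForm_ne_zero
      (linForm_ne_zero hβ hδ hz.2.1 hz.2.2.1 hz.2.2.2.1)
  refine ⟨fun z hz => (hT z hz).1.contDiffWithinAt, fun z hz => ?_, ?_⟩
  · have hy : z.1 1 ∈ I := hz.1
    have h0 := (defect_eq_zero_iff (cubicCoef α β) (hA _ hy)).2 ((solvesODE_iff hβ hδ).1 hode _ hy)
    rw [poisson_of_logForm (h.2.2.2.2.1 _ hy) (hT z hz).2.2,
      logForm_hamVec (h.2.2.2.1 _ hy) (hC z hz) (coefL_pow_three g _), h0]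
    simp
  · refine (regularRegion_subset_closure α β ρ I g).trans (closure_mono fun z hz => ⟨hz.1, ?_⟩)
    have hy : z.1 1 ∈ I := hz.1.1
    exact linearIndependent_of_logForm (h.2.2.2.2.1 _ hy) (hT z hz.1).2.2 (hT z hz.1).2.1 hS
      (h.2.2.2.1 _ hy) (coefL_ne_zero (hA _ hy)) (hC z hz.1) hz.2

theorem integralT_ne_zero {z : Phase} (h6 : K₆ α β ρ g z ≠ 0) (h7 : K₇ α β ρ g z ≠ 0)
    (h8 : K₈ α β g z ≠ 0) : integralT α β ρ g Q z ≠ 0 := by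
  simp [integralT, K₉, Complex.cpow_eq_zero_iff, h6, h7, h8]

theorem isBranchPoint_of_mem {z : Phase} (hz : z ∈ regularRegion α β ρ I g)
    (hA : coefA g (z.1 1) ≠ 0) :
    IsBranchPoint (K₆ α β ρ g) z ∧ IsBranchPoint (K₇ α β ρ g) z := by
  have h : ρ.im = 0 ∨ coefL g (z.1 1) * z.2 1 ≠ 0 ∨ ∀ᶠ y in 𝓝 (z.1 1), coefL g y = 0 :=
    hz.2.2.2.2.imp_right fun h => Or.inl (mul_ne_zero (coefL_ne_zero hA) h)
  exact ⟨isBranchPoint_of_im hz.2.1 (K₆_im ρ g) h, isBranchPoint_of_im hz.2.2.1 (K₇_im ρ g) h⟩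

theorem isIntegrableWith_integralT (h : IsSetting I g G Q) (hα : α ≠ 0) (hβ : β ≠ 0)
    (hδ : delta α β ≠ 0) (hρ : ρ ^ 2 = ((β ^ 2 - 4 * α : ℝ) : ℂ)) (hρ0 : ρ ≠ 0)
    (hode : SolvesODE α β I g) (hA : ∀ y ∈ I, coefA g y ≠ 0) :
    IsIntegrableWith (hamiltonian G) (regularRegion α β ρ I g) (integralT α β ρ g Q) := by
  refine isIntegrableWith_of_logForm h hβ hδ hρ hode hA
    (secondMoment_ne_zero hα hβ hδ hρ0 one_ne_zero) fun z hz => ?_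
  have hy : z.1 1 ∈ I := hz.1
  have ⟨b6, b7⟩ := isBranchPoint_of_mem hz (hA _ hy)
  have b8 : IsBranchPoint (K₈ α β g) z := ⟨hz.2.2.2.1, Or.inr (Eventually.of_forall (K₈_im g))⟩
  have ⟨s6, s7, s8⟩ := contDiffAt_K h hβ hδ hy (hA _ hy) ρ
  refine ⟨(((b6.contDiffAt_cpow s6 _).mul (b7.contDiffAt_cpow s7 _)).mul
    (b8.contDiffAt_cpow s8 _)).mul (contDiffAt_exp_Q h hA hy _),
    integralT_ne_zero hz.2.1 hz.2.2.1 hz.2.2.2.1, ?_⟩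
  exact hasLogFDerivAt_integralT hβ hδ hρ (h.hasDerivAt_g hy) (h.hasDerivAt_coefL hy (hA _ hy))
    (h.2.2.2.2.2 _ hy) b6 b7 hz.2.2.2.1

theorem isIntegrableWith_integralTr {r : ℚ} (h : IsSetting I g G Q) (hα : α ≠ 0) (hβ : β ≠ 0)
    (hδ : delta α β ≠ 0) (hρ : ((β : ℂ) * r) ^ 2 = ((β ^ 2 - 4 * α : ℝ) : ℂ)) (hr : r ≠ 0)
    (hode : SolvesODE α β I g) (hA : ∀ y ∈ I, coefA g y ≠ 0) :
    IsIntegrableWith (hamiltonian G) (regularRegion α β (β * r) I g) (integralTr α β r g Q) := by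
  have hβ' : (β : ℂ) ≠ 0 := by exact_mod_cast hβ
  have hr' : (r : ℂ) ≠ 0 := by exact_mod_cast hr
  refine isIntegrableWith_of_logForm h hβ hδ hρ hode hA
    (secondMoment_ne_zero hα hβ hδ (mul_ne_zero hβ' hr')
      (div_ne_zero (Nat.cast_ne_zero.2 r.den_ne_zero) hβ')) fun z hz => ?_
  have hy : z.1 1 ∈ I := hz.1
  have ⟨s6, s7, s8⟩ := contDiffAt_K h hβ hδ hy (hA _ hy) (β * r)
  refine ⟨?_, ?_, hasLogFDerivAt_integralTr hβ hδ hρ (h.hasDerivAt_g hy)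
    (h.hasDerivAt_coefL hy (hA _ hy)) (h.2.2.2.2.2 _ hy) hz.2.1 hz.2.2.1 hz.2.2.2.1⟩
  · rw [integralTr_eq]
    exact (((contDiffAt_zpow_comp hz.2.1 s6 _).mul (contDiffAt_zpow_comp hz.2.2.1 s7 _)).mul
      (contDiffAt_zpow_comp hz.2.2.2.1 s8 _)).mul (contDiffAt_exp_Q h hA hy _)
  · rw [integralTr_eq]
    exact mul_ne_zero (mul_ne_zero (mul_ne_zero (zpow_ne_zero _ hz.2.1)
      (zpow_ne_zero _ hz.2.2.1)) (zpow_ne_zero _ hz.2.2.2.1)) (Complex.exp_ne_zero _)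

/-! ### Necessity of the differential equation -/

theorem ode_of_poisson_eq_zero (h : IsSetting I g G Q) (hα : α ≠ 0) (hβ : β ≠ 0)
    (hδ : delta α β ≠ 0) (hρ : ρ ^ 2 = ((β ^ 2 - 4 * α : ℝ) : ℂ)) (hρ0 : ρ ≠ 0)
    (hT : ∀ z ∈ regularRegion α β ρ I g,
      poisson (integralT α β ρ g Q) (fun w => (hamiltonian G w : ℂ)) z = 0)
    {y : ℝ} (hy : y ∈ I) (hA : coefA g y ≠ 0) :
    g y * deriv (coefA g) y - coefB g y * coefA g y =
      cubicCoef α β * coefA g y * coefL g y ^ 2 := by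
  have hg := h.2.2.2.1 _ hy
  have hl := coefL_ne_zero hA
  -- Only finitely many values of X are bad: X = 0, where the contracted form vanishes in any case,
  -- and the real parts of -t l, which cover all real zeros of the three forms. Taking p₂ = 1 stays
  -- in the region also for non-real ρ.
  obtain ⟨X, hX⟩ := Infinite.exists_notMem_finset
    (insert 0 (Finset.univ.image fun i => (-(formRoot α β ρ i * coefL g y)).re))
  have hX0 : X ≠ 0 := fun h => hX (by simp [h])
  obtain ⟨z, hzy, hz2, hzX⟩ : ∃ z : Phase, z.1 1 = y ∧ z.2 1 = 1 ∧ formX g z = X :=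
    ⟨(![0, y], ![(X - 1) / (3 * g y), 1]), rfl, rfl, by simp [formX]; field_simp; ring⟩
  subst hzy
  have hzY : formY (coefL g) z = coefL g (z.1 1) := by simp [formY, hz2]
  have h0 : ∀ i, linForm (formRoot α β ρ i) (coefL g) g z ≠ 0 := fun i hi => hX <| by
    rw [linForm, hzX, hzY] at hi
    refine Finset.mem_insert_of_mem (Finset.mem_image.2 ⟨i, Finset.mem_univ _, ?_⟩)
    rw [← eq_neg_of_add_eq_zero_left hi, Complex.ofReal_re]
  have ⟨h6, h7, h8⟩ := K_ne_zero_of_linForm hβ hδ h0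
  have hz : z ∈ regularRegion α β ρ I g :=
    ⟨hy, h6, h7, h8, Or.inr (by rw [hz2]; exact one_ne_zero)⟩
  have ⟨b6, b7⟩ := isBranchPoint_of_mem hz hA
  have hC := (isFactorization hβ hδ hρ 1).cubicForm_ne_zero h0
  have hp := hT z hz
  rw [poisson_of_logForm (h.2.2.2.2.1 _ hy) (hasLogFDerivAt_integralT hβ hδ hρ
    (h.hasDerivAt_g hy) (h.hasDerivAt_coefL hy hA) (h.2.2.2.2.2 _ hy) b6 b7 h8),
    logForm_hamVec hg hC (coefL_pow_three g _)] at hp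
  have hT0 : integralT α β ρ g Q z ≠ 0 := integralT_ne_zero h6 h7 h8
  have hS := secondMoment_ne_zero hα hβ hδ hρ0 one_ne_zero
  have hlam : (conformalFactor G z.1 : ℂ) ≠ 0 := by exact_mod_cast (conformalFactor_pos G z.1).ne'
  have hp' := (mul_eq_zero.1 ((mul_eq_zero.1 ((mul_eq_zero.1 hp).resolve_left hlam)).resolve_left
    hT0)).resolve_left hS
  rw [Complex.ofReal_eq_zero, div_eq_zero_iff] at hp'
  have hp2 := hp'.resolve_right (mul_ne_zero (mul_ne_zero three_ne_zero hg) hC)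
  refine (defect_eq_zero_iff _ hA).1 ((mul_eq_zero.1 hp2).resolve_left ?_)
  rw [hzX, hzY, hz2]
  exact mul_ne_zero (mul_ne_zero (pow_ne_zero 2 one_ne_zero) hX0) hl

/-- If A vanished near a point, then l and Y would too. The logarithmic differential, a multiple of
`logForm`, would be zero, so dT = 0 on a nonempty open part of the region, against independence on a
dense subset. -/
theorem not_eventually_coefA_eq_zero (h : IsSetting I g G Q) (hβ : β ≠ 0)
    (hδ : delta α β ≠ 0) (hρ : ρ ^ 2 = ((β ^ 2 - 4 * α : ℝ) : ℂ))
    (hT : IsIntegrableWith (hamiltonian G) (regularRegion α β ρ I g) (integralT α β ρ g Q))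
    {y : ℝ} (hy : y ∈ I) : ¬ ∀ᶠ s in 𝓝 y, coefA g s = 0 := by
  intro hev
  have hL : ∀ {s}, coefA g s = 0 → coefL g s = 0 := fun hs => by rw [coefL, hs, cbrt_zero]
  let z : Phase := (![0, y], ![0, 1])
  have h0 : ∀ i, linForm (formRoot α β ρ i) (coefL g) g z ≠ 0 := fun i => by
    simp [linForm, formX, formY, z, hL hev.self_of_nhds]
  have ⟨h6, h7, h8⟩ := K_ne_zero_of_linForm hβ hδ h0
  have hz : z ∈ regularRegion α β ρ I g :=
    ⟨hy, h6, h7, h8, Or.inr (show (1 : ℝ) ≠ 0 from one_ne_zero)⟩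
  have hc : ContinuousAt (fun w : Phase => w.1 1) z := (baseCovec 1).continuous.continuousAt
  have hW : {w : Phase | ∀ᶠ s in 𝓝 (w.1 1), coefA g s = 0} ∈ 𝓝 z :=
    hc.eventually (eventually_eventually_nhds.2 hev)
  obtain ⟨w, hw, hwU, hind⟩ := mem_closure_iff_nhds.1 (hT.2.2 hz) _ hW
  have hw' : ∀ᶠ s in 𝓝 (w.1 1), coefL g s = 0 := hw.mono fun s hs => hL hs
  have hwI : w.1 1 ∈ I := hwU.1
  have hl : HasDerivAt (coefL g) 0 (w.1 1) :=
    (hasDerivAt_const (w.1 1) (0 : ℝ)).congr_of_eventuallyEq hw'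
  have hd := hasLogFDerivAt_integralT hβ hδ hρ (h.hasDerivAt_g hwI) hl (h.2.2.2.2.2 _ hwI)
    (isBranchPoint_of_im hwU.2.1 (K₆_im ρ g) (Or.inr (Or.inr hw')))
    (isBranchPoint_of_im hwU.2.2.1 (K₇_im ρ g) (Or.inr (Or.inr hw'))) hwU.2.2.2.1
  have hform : logForm (cubicCoef α β) (coefL g) g 0 (deriv g (w.1 1)) w = 0 := by
    simp [logForm, formY, hw'.self_of_nhds]
  have hd0 : fderiv ℝ (integralT α β ρ g Q) w = 0 := by
    rw [HasFDerivAt.fderiv hd, hform]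
    exact ContinuousLinearMap.ext fun v => by simp
  exact hind.ne_zero 0 hd0

theorem coefA_ne_zero_of_ode (h : IsSetting I g G Q) (k : ℝ)
    (hode : ∀ y ∈ I, g y * deriv (coefA g) y - coefB g y * coefA g y =
      k * coefA g y * coefL g y ^ 2) {y₀ : ℝ} (hy₀ : y₀ ∈ I) (h0 : coefA g y₀ = 0) :
    ∀ y ∈ I, coefA g y = 0 := by
  have hL : ContinuousOn (coefL g) I :=
    continuous_cbrt.comp_continuousOn (contDiffOn_coefA h.1 h.2.2.1).continuousOn
  refine eq_zero_of_linear_ode h.1 h.2.1 (φ := fun y => (coefB g y + k * coefL g y ^ 2) / g y)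
    (((contDiffOn_coefB h.1 h.2.2.1).continuousOn.add
      (continuousOn_const.mul (hL.pow 2))).div h.2.2.1.continuousOn h.2.2.2.1)
    (fun y hy => (h.hasDerivAt_coefA hy).congr_deriv ?_) hy₀ h0
  have := h.2.2.2.1 y hy
  field_simp
  linear_combination hode y hy

theorem solvesODE_of_isIntegrableWith (h : IsSetting I g G Q) (hα : α ≠ 0) (hβ : β ≠ 0)
    (hδ : delta α β ≠ 0) (hρ : ρ ^ 2 = ((β ^ 2 - 4 * α : ℝ) : ℂ)) (hρ0 : ρ ≠ 0)
    (hT : IsIntegrableWith (hamiltonian G) (regularRegion α β ρ I g) (integralT α β ρ g Q)) :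
    SolvesODE α β I g ∧ ∀ y ∈ I, coefA g y ≠ 0 := by
  have hden := fun {y} (hy : y ∈ I) => not_eventually_coefA_eq_zero h hβ hδ hρ hT hy
  have hcA := contDiffOn_coefA h.1 h.2.2.1
  have hL : ContinuousOn (coefL g) I := continuous_cbrt.comp_continuousOn hcA.continuousOn
  have hcont : ContinuousOn (fun y => g y * deriv (coefA g) y - coefB g y * coefA g y
      - cubicCoef α β * coefA g y * coefL g y ^ 2) I :=
    ((h.2.2.1.continuousOn.mul (contDiffOn_deriv_of_isOpen h.1 hcA).continuousOn).sub
      ((contDiffOn_coefB h.1 h.2.2.1).continuousOn.mul hcA.continuousOn)).sub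
      ((continuousOn_const.mul hcA.continuousOn).mul (hL.pow 2))
  -- If the reduced equation failed at y it would fail nearby, and the bracket condition would force
  -- A = 0 throughout that neighbourhood.
  have hode : ∀ y ∈ I, g y * deriv (coefA g) y - coefB g y * coefA g y =
      cubicCoef α β * coefA g y * coefL g y ^ 2 := by
    intro y hy
    by_contra hne
    refine hden hy ?_
    filter_upwards [h.1.mem_nhds hy, (hcont.continuousAt (h.1.mem_nhds hy)).eventually_ne
      (sub_ne_zero.2 hne)] with s hs hs'
    by_contra hAs
    exact hs' (sub_eq_zero.2 (ode_of_poisson_eq_zero h hα hβ hδ hρ hρ0 hT.2.1 hs hAs))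
  refine ⟨(solvesODE_iff hβ hδ).2 hode, fun y hy h0 => hden hy ?_⟩
  filter_upwards [h.1.mem_nhds hy] with s hs
  exact coefA_ne_zero_of_ode h _ hode hy h0 s hs

end Integrability

/-! ### Relative Killing tensors -/

section Killing
variable {α β : ℝ} {ρ : ℂ} {I : Set ℝ} {g G Q : ℝ → ℝ}

theorem isHomogeneousInMomenta_zero {Ω : Set (Fin 2 → ℝ)} {u : (Fin 2 → ℝ) → ℂ}
    (hu : ContDiffOn ℝ ∞ u Ω) : IsHomogeneousInMomenta Ω 0 fun z => u z.1 := by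
  refine ⟨fun q => MvPolynomial.C (u q), fun s => ?_, fun q _ =>
    ⟨MvPolynomial.isHomogeneous_C _ _, fun p => by simp⟩⟩
  simp only [MvPolynomial.coeff_C]
  split_ifs
  exacts [hu, contDiffOn_const]

theorem isHomogeneousInMomenta_one {Ω : Set (Fin 2 → ℝ)} {u v : (Fin 2 → ℝ) → ℂ}
    (hu : ContDiffOn ℝ ∞ u Ω) (hv : ContDiffOn ℝ ∞ v Ω) :
    IsHomogeneousInMomenta Ω 1 fun z => u z.1 * z.2 0 + v z.1 * z.2 1 := by
  refine ⟨fun q => MvPolynomial.C (u q) * MvPolynomial.X 0 + MvPolynomial.C (v q) *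
    MvPolynomial.X 1, fun s => ?_, fun q _ => ⟨?_, fun p => by simp⟩⟩
  · simp only [MvPolynomial.coeff_add, MvPolynomial.coeff_C_mul]
    exact (hu.mul contDiffOn_const).add (hv.mul contDiffOn_const)
  · exact ((MvPolynomial.isHomogeneous_X ℂ 0).C_mul _).add
      ((MvPolynomial.isHomogeneous_X ℂ 1).C_mul _)

theorem contDiffOn_ofReal_base {f : ℝ → ℝ} (hf : ContDiffOn ℝ ∞ f I) :
    ContDiffOn ℝ ∞ (fun q : Fin 2 → ℝ => (f (q 1) : ℂ)) (baseRegion I) :=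
  Complex.ofRealCLM.contDiff.comp_contDiffOn
    (hf.comp (contDiff_apply ℝ ℝ (1 : Fin 2)).contDiffOn fun _ hq => hq)

theorem contDiffOn_conformalFactor (h : IsSetting I g G Q) :
    ContDiffOn ℝ ∞ (conformalFactor G) (baseRegion I) := by
  have hG : ContDiffOn ℝ ∞ G I := by
    rw [contDiffOn_infty_iff_deriv_of_isOpen h.1]
    exact ⟨fun y hy => (h.2.2.2.2.1 y hy).differentiableAt.differentiableWithinAt,
      h.2.2.1.congr fun y hy => (h.2.2.2.2.1 y hy).deriv⟩
  exact (contDiffOn_const.mul ((hG.comp (contDiff_apply ℝ ℝ (1 : Fin 2)).contDiffOn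
    fun _ hq => hq).sub (contDiff_apply ℝ ℝ (0 : Fin 2)).contDiffOn)).exp

theorem isRelativeKilling_linForm (h : IsSetting I g G Q) (hA : ∀ y ∈ I, coefA g y ≠ 0) {k : ℝ}
    (hode : ∀ y ∈ I, g y * deriv (coefA g) y - coefB g y * coefA g y =
      k * coefA g y * coefL g y ^ 2) {t c : ℂ} (ht : t ^ 3 - 3 * k * t - 1 = 0)
    {K : Phase → ℂ} (hK : ∀ z, K z = c * linForm t (coefL g) g z) :
    IsRelativeKilling (hamiltonian G) (baseRegion I) 1 K := by
  have hgs := contDiffOn_ofReal_base h.2.2.1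
  have hgs' := contDiffOn_ofReal_base (contDiffOn_deriv_of_isOpen h.1 h.2.2.1)
  have hls := contDiffOn_ofReal_base (contDiffOn_coefL h.1 h.2.2.1 hA)
  have hlam : ContDiffOn ℝ ∞ (fun q => (conformalFactor G q : ℂ)) (baseRegion I) :=
    Complex.ofRealCLM.contDiff.comp_contDiffOn (contDiffOn_conformalFactor h)
  have h1 := isHomogeneousInMomenta_one (Ω := baseRegion I)
    (u := fun q => c * (3 * g (q 1))) (v := fun q => c * (1 + t * coefL g (q 1)))
    (contDiffOn_const.mul (contDiffOn_const.mul hgs))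
    (contDiffOn_const.mul (contDiffOn_const.add (contDiffOn_const.mul hls)))
  -- The cofactor is the quotient of the quadratic form {H, K} by K: its two coefficients are found
  -- by matching p₁² and p₁p₂.
  have h2 := isHomogeneousInMomenta_one (Ω := baseRegion I)
    (u := fun q => conformalFactor G q * ((t * coefL g (q 1) - 2) / 3))
    (v := fun q => conformalFactor G q * (-(9 * deriv g (q 1)
      + (t * coefL g (q 1) + 1) * (t * coefL g (q 1) - 2)) * (9 * (g (q 1) : ℂ))⁻¹))
    (hlam.mul (((contDiffOn_const.mul hls).sub contDiffOn_const).div_const _))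
    (hlam.mul (((contDiffOn_const.mul hgs').add (((contDiffOn_const.mul hls).add
      contDiffOn_const).mul ((contDiffOn_const.mul hls).sub contDiffOn_const))).neg.mul
      ((contDiffOn_const.mul hgs).inv fun q hq => mul_ne_zero (by norm_num)
        (Complex.ofReal_ne_zero.2 (h.2.2.2.1 _ hq)))))
  refine ⟨?_, _, h2, fun q hq p => ?_⟩
  · convert h1 using 2 with z
    rw [hK, linForm, formX, formY]
    push_cast
    ring
  · have hy : q 1 ∈ I := hq
    have hd := (hasFDerivAt_linForm (z := (q, p)) t (h.hasDerivAt_coefL hy (hA _ hy))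
      (h.hasDerivAt_g hy)).const_mul c
    have h0 := (defect_eq_zero_iff k (hA _ hy)).2 (hode _ hy)
    have hA3 := coefL_pow_three g (q 1)
    have hg := h.2.2.2.1 _ hy
    rw [poisson_antisymm, poisson_hamiltonian (h.2.2.2.2.1 _ hy), funext hK, hd.fderiv]
    rw [coefA] at hA3
    generalize hl₁ : deriv (coefA g) (q 1) / (3 * coefL g (q 1) ^ 2) = l₁ at *
    simp only [dFormX, dFormY, hamVec, linForm, formX, formY, add_apply,
      smul_apply, ContinuousLinearMap.comp_apply, Complex.ofRealCLM_apply, baseCovec_apply,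
      momCovec_apply, smul_eq_mul, Matrix.cons_val_zero, Matrix.cons_val_one]
    generalize coefL g (q 1) = l at *
    generalize deriv g (q 1) = g₁ at *
    generalize g (q 1) = g₀ at *
    have h0' : (k : ℂ) * l ^ 3 + l * (3 * g₁ + 3 * g₀ ^ 2 - 1) - 3 * g₀ * l₁ = 0 := by
      exact_mod_cast h0
    have hA3' : (l : ℂ) ^ 3 = 18 * g₀ ^ 2 + 2 - 9 * g₁ := by exact_mod_cast hA3
    have hg' : (g₀ : ℂ) ≠ 0 := Complex.ofReal_ne_zero.2 hg
    push_cast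
    field_simp
    -- Only the p₂² coefficient is left; it vanishes by the differential equation, the cubic for t
    -- and l³ = A.
    linear_combination (3 * conformalFactor G q * c * p 1 ^ 2 : ℂ) *
      (3 * t * h0' + l ^ 3 * ht + hA3')

theorem isRelativeKilling_K₉ (h : IsSetting I g G Q) (hA : ∀ y ∈ I, coefA g y ≠ 0) (ρ : ℂ) :
    IsRelativeKilling (hamiltonian G) (baseRegion I) 0 (K₉ α β ρ Q) := by
  have hgs := contDiffOn_ofReal_base h.2.2.1
  have hls := contDiffOn_ofReal_base (contDiffOn_coefL h.1 h.2.2.1 hA)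
  have hQs := contDiffOn_ofReal_base (h.contDiffOn_Q hA)
  have hlam : ContDiffOn ℝ ∞ (fun q => (conformalFactor G q : ℂ)) (baseRegion I) :=
    Complex.ofRealCLM.contDiff.comp_contDiffOn (contDiffOn_conformalFactor h)
  have h2 := isHomogeneousInMomenta_one (Ω := baseRegion I) (u := fun _ => 0)
    (v := fun q => -(conformalFactor G q * (2 * α * ρ * ((cbrt (delta α β * β) : ℂ) ^ 2)⁻¹ *
      ((coefL g (q 1) : ℂ) ^ 2 * (g (q 1) : ℂ)⁻¹)))) contDiffOn_const
    (hlam.mul (contDiffOn_const.mul ((hls.pow 2).mul (hgs.inv fun q hq =>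
      Complex.ofReal_ne_zero.2 (h.2.2.2.1 _ hq))))).neg
  refine ⟨isHomogeneousInMomenta_zero (u := fun q => Complex.exp
    (2 * α * ρ * ((cbrt (delta α β * β) : ℂ) ^ 2)⁻¹ * Q (q 1)))
    (contDiffOn_const.mul hQs).cexp, _, h2, fun q hq p => ?_⟩
  have hy : q 1 ∈ I := hq
  have hd : HasFDerivAt (K₉ α β ρ Q) _ (q, p) := (((hasFDerivAt_ofReal_comp
    (hasFDerivAt_comp_base (z := (q, p)) 1 (h.2.2.2.2.2 _ hy))).const_mul
      (2 * α * ρ * ((cbrt (delta α β * β) : ℂ) ^ 2)⁻¹))).cexp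
  rw [poisson_antisymm, poisson_hamiltonian (h.2.2.2.2.1 _ hy), hd.fderiv, K₉]
  simp [hamVec]
  ring

theorem isRelativeKilling_K (h : IsSetting I g G Q) (hβ : β ≠ 0) (hδ : delta α β ≠ 0)
    (hρ : ρ ^ 2 = ((β ^ 2 - 4 * α : ℝ) : ℂ)) (hode : SolvesODE α β I g)
    (hA : ∀ y ∈ I, coefA g y ≠ 0) :
    IsRelativeKilling (hamiltonian G) (baseRegion I) 1 (K₆ α β ρ g) ∧
      IsRelativeKilling (hamiltonian G) (baseRegion I) 1 (K₇ α β ρ g) ∧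
      IsRelativeKilling (hamiltonian G) (baseRegion I) 1 (K₈ α β g) := by
  have hode' := (solvesODE_iff hβ hδ).1 hode
  have hf := isFactorization hβ hδ hρ 1
  -- Vieta's relations turn the symmetric functions in the factorization into the cubic equation for
  -- each root.
  have ht : ∀ i, formRoot α β ρ i ^ 3 - 3 * cubicCoef α β * formRoot α β ρ i - 1 = 0 := by
    have h1 := hf.sum_root
    have h2 := hf.sum_root_mul
    have h3 := hf.root_mul
    refine Fin.forall_fin_succ.2 ⟨?_, Fin.forall_fin_two.2 ⟨?_, ?_⟩⟩
    · change formRoot α β ρ 0 ^ 3 - 3 * cubicCoef α β * formRoot α β ρ 0 - 1 = 0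
      linear_combination formRoot α β ρ 0 ^ 2 * h1 - formRoot α β ρ 0 * h2 + h3
    · change formRoot α β ρ 1 ^ 3 - 3 * cubicCoef α β * formRoot α β ρ 1 - 1 = 0
      linear_combination formRoot α β ρ 1 ^ 2 * h1 - formRoot α β ρ 1 * h2 + h3
    · change formRoot α β ρ 2 ^ 3 - 3 * cubicCoef α β * formRoot α β ρ 2 - 1 = 0
      linear_combination formRoot α β ρ 2 ^ 2 * h1 - formRoot α β ρ 2 * h2 + h3
  exact ⟨isRelativeKilling_linForm h hA hode' (ht 0) (K₆_eq hβ hδ ρ g),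
    isRelativeKilling_linForm h hA hode' (ht 1) (K₇_eq hβ hδ ρ g),
    isRelativeKilling_linForm h hA hode' (ht 2) (K₈_eq hβ hδ ρ g)⟩

end Killing

/-! ### The rational integral -/

section Rational

/-- A family of polynomials in the momenta whose coefficients are smooth on `Ω`. -/
def SmoothCoeffs (Ω : Set (Fin 2 → ℝ)) (P : (Fin 2 → ℝ) → MvPolynomial (Fin 2) ℝ) : Prop :=
  ∀ s, ContDiffOn ℝ ∞ (fun q => (P q).coeff s) Ω

variable {Ω : Set (Fin 2 → ℝ)} {P R : (Fin 2 → ℝ) → MvPolynomial (Fin 2) ℝ}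

theorem SmoothCoeffs.mul (hP : SmoothCoeffs Ω P) (hR : SmoothCoeffs Ω R) :
    SmoothCoeffs Ω fun q => P q * R q := fun s => by
  simp only [MvPolynomial.coeff_mul]
  exact ContDiffOn.sum fun x _ => (hP x.1).mul (hR x.2)

theorem smoothCoeffs_C {u : (Fin 2 → ℝ) → ℝ} (hu : ContDiffOn ℝ ∞ u Ω) :
    SmoothCoeffs Ω fun q => MvPolynomial.C (u q) := fun s => by
  simp only [MvPolynomial.coeff_C]
  split_ifs
  exacts [hu, contDiffOn_const]

theorem SmoothCoeffs.pow (hP : SmoothCoeffs Ω P) (n : ℕ) : SmoothCoeffs Ω fun q => P q ^ n := by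
  induction n with
  | zero => simpa using smoothCoeffs_C (Ω := Ω) (u := fun _ => 1) contDiffOn_const
  | succ n ih => simpa only [pow_succ] using ih.mul hP

/-- The linear polynomial `u X₀ + v X₁`. -/
def linPoly (u v : ℝ) : MvPolynomial (Fin 2) ℝ :=
  MvPolynomial.C u * MvPolynomial.X 0 + MvPolynomial.C v * MvPolynomial.X 1

theorem smoothCoeffs_linPoly {u v : (Fin 2 → ℝ) → ℝ} (hu : ContDiffOn ℝ ∞ u Ω)
    (hv : ContDiffOn ℝ ∞ v Ω) : SmoothCoeffs Ω fun q => linPoly (u q) (v q) := fun s => by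
  simp only [linPoly, MvPolynomial.coeff_add, MvPolynomial.coeff_C_mul]
  exact (hu.mul contDiffOn_const).add (hv.mul contDiffOn_const)

theorem isHomogeneous_linPoly (u v : ℝ) : (linPoly u v).IsHomogeneous 1 :=
  ((MvPolynomial.isHomogeneous_X ℝ 0).C_mul u).add ((MvPolynomial.isHomogeneous_X ℝ 1).C_mul v)

@[simp] theorem eval_linPoly (u v : ℝ) (p : Fin 2 → ℝ) :
    MvPolynomial.eval p (linPoly u v) = u * p 0 + v * p 1 := by simp [linPoly]

/-- By Cramer's rule a common divisor divides the determinant times each variable, hence both X₀ and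
X₁, which are coprime. -/
theorem isRelPrime_linPoly {u v u' v' : ℝ} (h : u * v' - u' * v ≠ 0) :
    IsRelPrime (linPoly u v) (linPoly u' v') := by
  intro d h1 h2
  have hX : ∀ i : Fin 2, d ∣ MvPolynomial.X i := by
    have hd : ∀ i : Fin 2, d ∣ MvPolynomial.C (u * v' - u' * v) * MvPolynomial.X i := by
      refine Fin.forall_fin_two.2 ⟨?_, ?_⟩
      · convert (h1.mul_left (MvPolynomial.C v')).sub (h2.mul_left (MvPolynomial.C v)) using 1
        simp only [linPoly, map_sub, map_mul]
        ring
      · convert (h2.mul_left (MvPolynomial.C u)).sub (h1.mul_left (MvPolynomial.C u')) using 1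
        simp only [linPoly, map_sub, map_mul]
        ring
    intro i
    exact ((h.isUnit.map MvPolynomial.C).dvd_mul_left).1 (hd i)
  have hrel : IsRelPrime (MvPolynomial.X 0 : MvPolynomial (Fin 2) ℝ) (MvPolynomial.X 1) :=
    (MvPolynomial.X_prime (i := 0)).irreducible.isRelPrime_iff_not_dvd.2 fun hdvd => by
      simp [MvPolynomial.X_dvd_X] at hdvd
  exact hrel (hX 0) (hX 1)

/-- A quotient of powers of three pairwise non-proportional linear forms, written as the product of
their integral powers `e`, is in lowest terms, of the degree of the positive part of `e`. -/
theorem isRationalOfDegree_prod {T : Phase → ℂ} {w : (Fin 2 → ℝ) → ℝ}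
    {u v : Fin 3 → (Fin 2 → ℝ) → ℝ} {e : Fin 3 → ℤ} {n : ℕ}
    (hw : ContDiffOn ℝ ∞ w Ω) (hw0 : ∀ q ∈ Ω, w q ≠ 0)
    (hu : ∀ i, ContDiffOn ℝ ∞ (u i) Ω) (hv : ∀ i, ContDiffOn ℝ ∞ (v i) Ω)
    (hdet : ∀ q ∈ Ω, ∀ i j, i ≠ j → u i q * v j q - u j q * v i q ≠ 0)
    (hpos : ∑ i, (e i).toNat = n) (hneg : ∑ i, (-e i).toNat = n)
    (hT : ∀ q ∈ Ω, ∀ p : Fin 2 → ℝ,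
      T (q, p) = ((w q * ∏ i, (u i q * p 0 + v i q * p 1) ^ e i : ℝ) : ℂ)) :
    IsRationalOfDegree Ω n T := by
  have hprod : ∀ f : Fin 3 → ℕ, SmoothCoeffs Ω fun q => ∏ i, linPoly (u i q) (v i q) ^ f i := by
    intro f
    simp only [Fin.prod_univ_three]
    exact (((smoothCoeffs_linPoly (hu 0) (hv 0)).pow _).mul
      ((smoothCoeffs_linPoly (hu 1) (hv 1)).pow _)).mul ((smoothCoeffs_linPoly (hu 2) (hv 2)).pow _)
  have hhom : ∀ (f : Fin 3 → ℕ) (q), (∏ i, linPoly (u i q) (v i q) ^ f i).IsHomogeneous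
      (∑ i, f i) := fun f q =>
    MvPolynomial.IsHomogeneous.prod _ _ _ fun i _ => by
      simpa using (isHomogeneous_linPoly (u i q) (v i q)).pow (f i)
  refine ⟨fun q => MvPolynomial.C (w q) * ∏ i, linPoly (u i q) (v i q) ^ (e i).toNat,
    fun q => ∏ i, linPoly (u i q) (v i q) ^ (-e i).toNat,
    (smoothCoeffs_C hw).mul (hprod _), hprod _, fun q hq => ⟨?_, hneg ▸ hhom _ q, ?_, ?_⟩⟩
  · exact hpos ▸ (hhom _ q).C_mul _
  · refine ((hw0 q hq).isUnit.map MvPolynomial.C).isRelPrime_left.mul_left ?_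
    refine IsRelPrime.prod_left fun i _ => IsRelPrime.prod_right fun j _ => ?_
    -- Each form occurs in the numerator or in the denominator but not in both, since `toNat` of e
    -- or of -e is zero.
    by_cases hij : i = j
    · subst hij
      rcases le_total 0 (e i) with h | h
      · rw [Int.toNat_of_nonpos (neg_nonpos.2 h), pow_zero]; exact isRelPrime_one_right
      · rw [Int.toNat_of_nonpos h, pow_zero]; exact isRelPrime_one_left
    · exact (isRelPrime_linPoly (hdet q hq i j hij)).pow
  · intro p _
    rw [hT q hq]
    congr 1
    simp only [map_mul, map_prod, map_pow, eval_linPoly, MvPolynomial.eval_C, mul_div_assoc]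
    rw [← Finset.prod_div_distrib]
    congr 1
    refine Finset.prod_congr rfl fun i _ => ?_
    rcases le_total 0 (e i) with h | h
    · rw [Int.toNat_of_nonpos (neg_nonpos.2 h), pow_zero, div_one, ← zpow_natCast,
        Int.toNat_of_nonneg h]
    · rw [Int.toNat_of_nonpos h, pow_zero, one_div, ← zpow_natCast,
        Int.toNat_of_nonneg (neg_nonneg.2 h), zpow_neg, inv_inv]

/-- The exponents of `K₆, K₇, K₈` in `T_r`. -/
def expTr (r : ℚ) : Fin 3 → ℤ := ![r.num + r.den, r.num - r.den, -2 * r.num]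

/-- As the exponents sum to zero, their positive part is half of |p+q| + |p-q| + 2|p|, which is |p|
+ max(|p|, q). -/
theorem sum_toNat_expTr (r : ℚ) : ∑ i, (expTr r i).toNat = degTr r := by
  have := r.den_pos
  simp only [expTr, degTr, Fin.sum_univ_three, Matrix.cons_val_zero, Matrix.cons_val_one,
    Matrix.cons_val]
  omega

theorem sum_toNat_neg_expTr (r : ℚ) : ∑ i, (-expTr r i).toNat = degTr r := by
  have := r.den_pos
  simp only [expTr, degTr, Fin.sum_univ_three, Matrix.cons_val_zero, Matrix.cons_val_one,
    Matrix.cons_val]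
  omega

variable {α β : ℝ} {r : ℚ} {I : Set ℝ} {g G Q : ℝ → ℝ}

/-- The real form of `formRoot` for `ρ = β r`. -/
def realRoot (α β r : ℝ) : Fin 3 → ℝ :=
  ![(β - 3 * (β * r)) / (2 * cbrt (delta α β * β)), (3 * (β * r) + β) / (2 * cbrt (delta α β * β)),
    -β / cbrt (delta α β * β)]

theorem formRoot_eq_realRoot (α β : ℝ) (r : ℚ) (i : Fin 3) :
    formRoot α β (β * r) i = (realRoot α β r i : ℂ) := by
  fin_cases i <;> simp [formRoot, realRoot]

/-- The differences of the roots are nonzero multiples of βr, β(1 - r) and β(1 + r). -/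
theorem realRoot_injective (hβ : β ≠ 0) (hδ : delta α β ≠ 0) (hr : IsAdmissible r) :
    Function.Injective (realRoot α β r) := by
  have hm : cbrt (delta α β * β) ≠ 0 := cbrt_ne_zero (mul_ne_zero hδ hβ)
  have h0 : (r : ℝ) ≠ 0 := by exact_mod_cast hr.1
  have h1 : (r : ℝ) ≠ 1 := by exact_mod_cast hr.2.1
  have h2 : (r : ℝ) ≠ -1 := by exact_mod_cast hr.2.2.1
  have e01 : realRoot α β r 0 ≠ realRoot α β r 1 := by
    simp only [realRoot, Matrix.cons_val_zero, Matrix.cons_val_one, ne_eq]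
    rw [div_left_inj' (mul_ne_zero two_ne_zero hm)]
    exact fun h => mul_ne_zero hβ h0 (by linarith)
  have e02 : realRoot α β r 0 ≠ realRoot α β r 2 := by
    simp only [realRoot, Matrix.cons_val_zero, Matrix.cons_val, ne_eq]
    rw [div_eq_div_iff (mul_ne_zero two_ne_zero hm) hm]
    exact fun h => mul_ne_zero (mul_ne_zero hm hβ) (sub_ne_zero.2 h1) (by linarith)
  have e12 : realRoot α β r 1 ≠ realRoot α β r 2 := by
    simp only [realRoot, Matrix.cons_val_one, Matrix.cons_val, ne_eq]
    rw [div_eq_div_iff (mul_ne_zero two_ne_zero hm) hm]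
    exact fun h => mul_ne_zero (mul_ne_zero hm hβ) (sub_ne_zero.2 h2) (by linarith)
  intro i j hij
  fin_cases i <;> fin_cases j <;> first
    | rfl
    | exact absurd hij e01
    | exact absurd hij e02
    | exact absurd hij e12
    | exact absurd hij.symm e01
    | exact absurd hij.symm e02
    | exact absurd hij.symm e12

theorem isRationalOfDegree_integralTr (h : IsSetting I g G Q) (hβ : β ≠ 0) (hδ : delta α β ≠ 0)
    (hr : IsAdmissible r) (hA : ∀ y ∈ I, coefA g y ≠ 0) :
    IsRationalOfDegree (baseRegion I) (degTr r) (integralTr α β r g Q) := by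
  have hb : ∀ {f : ℝ → ℝ}, ContDiffOn ℝ ∞ f I →
      ContDiffOn ℝ ∞ (fun q : Fin 2 → ℝ => f (q 1)) (baseRegion I) := fun hf =>
    hf.comp (contDiff_apply ℝ ℝ (1 : Fin 2)).contDiffOn fun _ hq => hq
  have hm : cbrt (delta α β * β) ≠ 0 := cbrt_ne_zero (mul_ne_zero hδ hβ)
  have hd : cbrt (delta α β) ≠ 0 := cbrt_ne_zero hδ
  let c : Fin 3 → ℝ := ![-2 * cbrt (delta α β * β), 2 * cbrt (delta α β * β), -cbrt (delta α β)]
  have hc : ∀ i, c i ≠ 0 := by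
    intro i; fin_cases i <;> simp [c, hm, hd]
  refine isRationalOfDegree_prod (e := expTr r)
    (w := fun q => Real.exp (2 * α * ((r.den / β) * (β * r)) *
      (cbrt (delta α β * β) ^ 2)⁻¹ * Q (q 1)))
    (u := fun i q => c i * (3 * g (q 1)))
    (v := fun i q => c i * (1 + realRoot α β r i * coefL g (q 1)))
    (contDiffOn_const.mul (hb (h.contDiffOn_Q hA))).exp (fun _ _ => Real.exp_ne_zero _)
    (fun i => contDiffOn_const.mul (contDiffOn_const.mul (hb h.2.2.1)))
    (fun i => contDiffOn_const.mul (contDiffOn_const.add (contDiffOn_const.mul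
      (hb (contDiffOn_coefL h.1 h.2.2.1 hA)))))
    (fun q hq i j hij => ?_) (sum_toNat_expTr r) (sum_toNat_neg_expTr r) fun q hq p => ?_
  · have hne : realRoot α β r j - realRoot α β r i ≠ 0 :=
      sub_ne_zero.2 fun he => hij (realRoot_injective hβ hδ hr he).symm
    rw [show c i * (3 * g (q 1)) * (c j * (1 + realRoot α β r j * coefL g (q 1))) -
        c j * (3 * g (q 1)) * (c i * (1 + realRoot α β r i * coefL g (q 1))) =
      3 * (c i * c j) * g (q 1) * coefL g (q 1) * (realRoot α β r j - realRoot α β r i) by ring]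
    exact mul_ne_zero (mul_ne_zero (mul_ne_zero (mul_ne_zero three_ne_zero
      (mul_ne_zero (hc i) (hc j))) (h.2.2.2.1 _ hq)) (coefL_ne_zero (hA _ hq))) hne
  · have hK : ∀ i, ((c i : ℝ) : ℂ) * linForm (formRoot α β (β * r) i) (coefL g) g (q, p) =
        ((c i * (3 * g (q 1)) * p 0 + c i * (1 + realRoot α β r i * coefL g (q 1)) * p 1 : ℝ) : ℂ) := by
      intro i
      rw [formRoot_eq_realRoot, linForm, formX, formY]
      push_cast
      ring
    obtain ⟨F, hF⟩ : ∃ F : Fin 3 → ℝ, ∀ i, c i * (3 * g (q 1)) * p 0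
        + c i * (1 + realRoot α β r i * coefL g (q 1)) * p 1 = F i := ⟨_, fun _ => rfl⟩
    simp only [hF] at hK ⊢
    have k6 : K₆ α β (β * r) g (q, p) = F 0 := by rw [K₆_eq hβ hδ, ← hK 0]; simp [c]
    have k7 : K₇ α β (β * r) g (q, p) = F 1 := by rw [K₇_eq hβ hδ, ← hK 1]; simp [c]
    have k8 : K₈ α β g (q, p) = F 2 := by rw [K₈_eq hβ hδ (β * r), ← hK 2]; simp [c]
    rw [integralTr_eq]
    simp only [k6, k7, k8, Fin.prod_univ_three, expTr, Matrix.cons_val_zero,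
      Matrix.cons_val_one, Matrix.cons_val]
    push_cast
    ring

end Rational

/-! ### Solutions of the differential equation -/

section Existence

/-- The vector field of the first-order system for `(g, A)`. -/
def systemField (k : ℝ) (u : ℝ × ℝ) : ℝ × ℝ :=
  ((18 * u.1 ^ 2 + 2 - u.2) / 9,
    ((9 * u.1 ^ 2 - 1 / 3 - u.2 / 3) * u.2 + k * u.2 * cbrt u.2 ^ 2) / u.1)

theorem contDiffOn_systemField (k : ℝ) :
    ContDiffOn ℝ ∞ (systemField k) (Set.Ioi 0 ×ˢ Set.Ioi 0) := by
  have hc : ContDiffOn ℝ ∞ (fun u : ℝ × ℝ => cbrt u.2) (Set.Ioi 0 ×ˢ Set.Ioi 0) := fun u hu =>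
    ((contDiffAt_cbrt (ne_of_gt hu.2)).comp u contDiff_snd.contDiffAt).contDiffWithinAt
  unfold systemField
  refine ContDiffOn.prodMk (by fun_prop) (ContDiffOn.div (by fun_prop) contDiff_fst.contDiffOn
    fun u hu => ne_of_gt hu.1)

theorem exists_smooth_solution (k : ℝ) : ∃ (ε : ℝ) (u : ℝ → ℝ × ℝ), 0 < ε ∧
    ContDiffOn ℝ ∞ u (Set.Ioo (-ε) ε) ∧ ∀ t ∈ Set.Ioo (-ε) ε,
      (0 < (u t).1 ∧ 0 < (u t).2) ∧ HasDerivAt u (systemField k (u t)) t := by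
  have hS : IsOpen (Set.Ioi (0 : ℝ) ×ˢ Set.Ioi (0 : ℝ)) := isOpen_Ioi.prod isOpen_Ioi
  -- Any initial point in the open quadrant would do: there both the division by g and the cube root
  -- of A are smooth.
  have h1 : ((1, 1) : ℝ × ℝ) ∈ Set.Ioi (0 : ℝ) ×ˢ Set.Ioi (0 : ℝ) := by simp
  obtain ⟨u, hu0, δ, hδ, hu⟩ :=
    ContDiffAt.exists_forall_mem_closedBall_exists_eq_forall_mem_Ioo_hasDerivAt₀
      (((contDiffOn_systemField k).contDiffAt (hS.mem_nhds h1)).of_le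
        (by exact_mod_cast le_top)) (0 : ℝ)
  simp only [zero_sub, zero_add] at hu
  have hcont : ContinuousAt u 0 := (hu 0 ⟨by linarith, hδ⟩).continuousAt
  have hmem : ∀ᶠ t in 𝓝 (0 : ℝ), u t ∈ Set.Ioi (0 : ℝ) ×ˢ Set.Ioi (0 : ℝ) :=
    hcont.eventually (by rw [hu0]; exact hS.mem_nhds h1)
  obtain ⟨η, hη, hball⟩ := Metric.eventually_nhds_iff_ball.1 hmem
  have hlt : ∀ t ∈ Set.Icc (-(min δ η / 2)) (min δ η / 2),
      u t ∈ Set.Ioi (0 : ℝ) ×ˢ Set.Ioi (0 : ℝ) ∧ t ∈ Set.Ioo (-δ) δ := by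
    intro t ht
    have hm : 0 < min δ η := lt_min hδ hη
    have hd := min_le_left δ η
    have he := min_le_right δ η
    refine ⟨hball t ?_, by linarith [ht.1], by linarith [ht.2]⟩
    rw [Real.ball_eq_Ioo]
    exact ⟨by linarith [ht.1], by linarith [ht.2]⟩
  -- Halving the radius keeps the closed interval inside the domain of the solution, so that
  -- smoothness can be bootstrapped from the vector field.
  refine ⟨min δ η / 2, u, half_pos (lt_min hδ hη), ?_, fun t ht =>
    ⟨(hlt t (Set.Ioo_subset_Icc_self ht)).1, hu t (hlt t (Set.Ioo_subset_Icc_self ht)).2⟩⟩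
  refine (ODE.contDiffOn_enat_Icc_of_hasDerivWithinAt (n := ⊤) (f := fun _ => systemField k)
    ((contDiffOn_systemField k).comp contDiff_snd.contDiffOn fun x hx => hx.2)
    (fun t ht => (hu t (hlt t ht).2).hasDerivWithinAt) fun t ht => (hlt t ht).1).mono
    Set.Ioo_subset_Icc_self

theorem exists_setting_solution {α β : ℝ} (hβ : β ≠ 0) (hδ : delta α β ≠ 0) :
    ∃ (I : Set ℝ) (g G Q : ℝ → ℝ), IsSetting I g G Q ∧ SolvesODE α β I g ∧
      ∀ y ∈ I, coefA g y ≠ 0 := by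
  obtain ⟨ε, u, hε, hsm, hu⟩ := exists_smooth_solution (cubicCoef α β)
  have hI : IsConnected (Set.Ioo (-ε) ε) := isConnected_Ioo (by linarith)
  have hg : ContDiffOn ℝ ∞ (fun y => (u y).1) (Set.Ioo (-ε) ε) := contDiff_fst.comp_contDiffOn hsm
  have hg0 : ∀ y ∈ Set.Ioo (-ε) ε, (u y).1 ≠ 0 := fun y hy => (hu y hy).1.1.ne'
  have hg' : ∀ y ∈ Set.Ioo (-ε) ε, HasDerivAt (fun y => (u y).1)
      ((18 * (u y).1 ^ 2 + 2 - (u y).2) / 9) y := fun y hy =>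
    (hu y hy).2.fst
  have hA : ∀ y ∈ Set.Ioo (-ε) ε, coefA (fun y => (u y).1) y = (u y).2 := fun y hy => by
    rw [coefA, (hg' y hy).deriv]; ring
  have hA' : ∀ y ∈ Set.Ioo (-ε) ε, HasDerivAt (coefA fun y => (u y).1)
      (((9 * (u y).1 ^ 2 - 1 / 3 - (u y).2 / 3) * (u y).2
        + cubicCoef α β * (u y).2 * cbrt (u y).2 ^ 2) / (u y).1) y := fun y hy =>
    HasDerivAt.congr_of_eventuallyEq (hu y hy).2.snd <| by
      filter_upwards [isOpen_Ioo.mem_nhds hy] with s hs using hA s hs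
  have hA0 : ∀ y ∈ Set.Ioo (-ε) ε, coefA (fun y => (u y).1) y ≠ 0 := fun y hy => by
    rw [hA y hy]; exact (hu y hy).1.2.ne'
  obtain ⟨G, hG⟩ := exists_antideriv isOpen_Ioo hI hg.continuousOn
  obtain ⟨Q, hQ⟩ := exists_antideriv isOpen_Ioo hI
    (((contDiffOn_coefL isOpen_Ioo hg hA0).continuousOn.pow 2).div hg.continuousOn hg0)
  refine ⟨Set.Ioo (-ε) ε, fun y => (u y).1, G, Q, ⟨isOpen_Ioo, hI, hg, hg0, hG, hQ⟩,
    (solvesODE_iff hβ hδ).2 fun y hy => ?_, hA0⟩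
  rw [(hA' y hy).deriv, coefB, (hg' y hy).deriv, coefL, hA y hy]
  have := hg0 y hy
  field_simp
  ring

/-- The choice r = 1/(n-1) has p = 1 and q = n-1, hence degree max(2, n) = n. For n = 4 it would be
the excluded value 1/3, and r = 2 takes its place. -/
theorem exists_admissible_degTr {n : ℕ} (hn : 3 ≤ n) : ∃ r : ℚ, IsAdmissible r ∧ degTr r = n := by
  by_cases h4 : n = 4
  · exact ⟨2, by norm_num [IsAdmissible], by simp [degTr, h4]⟩
  obtain ⟨m, rfl⟩ : ∃ m, n = m + 1 := ⟨n - 1, by omega⟩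
  have hm : m ≠ 0 := by omega
  refine ⟨(m : ℚ)⁻¹, ⟨?_, ?_, ?_, ?_, ?_⟩, ?_⟩
  · simpa using hm
  · rw [ne_eq, inv_eq_one]
    exact_mod_cast (by omega : m ≠ 1)
  · have : (0 : ℚ) < (m : ℚ)⁻¹ := by positivity
    linarith
  · rw [one_div, ne_eq, inv_inj]
    exact_mod_cast (by omega : m ≠ 3)
  · have : (0 : ℚ) < (m : ℚ)⁻¹ := by positivity
    linarith
  · have h1 : ((m : ℚ)⁻¹).num = 1 := by simp [Nat.pos_of_ne_zero hm]
    have h2 : ((m : ℚ)⁻¹).den = m := by simp [hm]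
    simp only [degTr, h1, h2]
    omega

end Existence

/-- Substituting for α, the values r = ±1 are exactly those with α = 0, and r = ±1/3 those with δ =
0. -/
theorem constants_ne_zero {α β : ℝ} {r : ℚ} (hβ : β ≠ 0)
    (h : 4 * α = β ^ 2 * (1 - (r : ℝ) ^ 2)) (hr : IsAdmissible r) : α ≠ 0 ∧ delta α β ≠ 0 := by
  have hc : ∀ s : ℚ, r ≠ s → (r : ℝ) - s ≠ 0 := fun s hs => sub_ne_zero.2 (by exact_mod_cast hs)
  have h1 := hc _ hr.2.1
  have h2 := hc _ hr.2.2.1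
  have h3 := hc _ hr.2.2.2.1
  have h4 := hc _ hr.2.2.2.2
  push_cast at h1 h2 h3 h4
  constructor
  · intro h0
    refine mul_ne_zero (pow_ne_zero 2 hβ) (mul_ne_zero h1 h2) ?_
    linear_combination h - 4 * h0
  · intro h0
    refine mul_ne_zero (pow_ne_zero 2 hβ) (mul_ne_zero h3 h4) ?_
    rw [delta] at h0
    linear_combination (4 / 9) * h0 + h

end ConformalGeodesic

end

theorem mainTheorem1 :
    -- the transcendental integral
    (∀ (α β : ℝ) (ρ : ℂ) (I : Set ℝ) (g G Q : ℝ → ℝ),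
      α ≠ 0 → β ≠ 0 → ρ ^ 2 = ((β ^ 2 - 4 * α : ℝ) : ℂ) → ρ ≠ 0 →
      2 * β ^ 2 - 9 * α ≠ 0 → β ^ 2 - 3 * α ≠ 0 → IsSetting I g G Q →
        (IsIntegrableWith (hamiltonian G) (regularRegion α β ρ I g) (integralT α β ρ g Q) ↔
          SolvesODE α β I g ∧ ∀ y ∈ I, coefA g y ≠ 0) ∧
        (SolvesODE α β I g → (∀ y ∈ I, coefA g y ≠ 0) →
          IsRelativeKilling (hamiltonian G) (baseRegion I) 1 (K₆ α β ρ g) ∧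
          IsRelativeKilling (hamiltonian G) (baseRegion I) 1 (K₇ α β ρ g) ∧
          IsRelativeKilling (hamiltonian G) (baseRegion I) 1 (K₈ α β g) ∧
          IsRelativeKilling (hamiltonian G) (baseRegion I) 0 (K₉ α β ρ Q))) ∧
    -- the rational integral
    (∀ (α β : ℝ) (r : ℚ) (I : Set ℝ) (g G Q : ℝ → ℝ),
      β ≠ 0 → 4 * α = β ^ 2 * (1 - (r : ℝ) ^ 2) → IsAdmissible r → IsSetting I g G Q →
      SolvesODE α β I g → (∀ y ∈ I, coefA g y ≠ 0) →
        IsIntegrableWith (hamiltonian G) (regularRegion α β (β * r) I g)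
          (integralTr α β r g Q) ∧
        IsRationalOfDegree (baseRegion I) (degTr r) (integralTr α β r g Q)) ∧
    -- its degree is arbitrary
    (∀ n : ℕ, 3 ≤ n → ∃ r : ℚ, IsAdmissible r ∧ degTr r = n ∧
      ∀ α β : ℝ, β ≠ 0 → 4 * α = β ^ 2 * (1 - (r : ℝ) ^ 2) →
        ∃ (I : Set ℝ) (g G Q : ℝ → ℝ), IsSetting I g G Q ∧
          SolvesODE α β I g ∧ ∀ y ∈ I, coefA g y ≠ 0) := by
  refine ⟨fun α β ρ I g G Q hα hβ hρ hρ0 hδ _ h => ⟨⟨?_, ?_⟩, ?_⟩, ?_, ?_⟩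
  · exact solvesODE_of_isIntegrableWith h hα hβ hδ hρ hρ0
  · exact fun ⟨hode, hA⟩ => isIntegrableWith_integralT h hα hβ hδ hρ hρ0 hode hA
  · intro hode hA
    have ⟨h6, h7, h8⟩ := isRelativeKilling_K h hβ hδ hρ hode hA
    exact ⟨h6, h7, h8, isRelativeKilling_K₉ h hA ρ⟩
  · intro α β r I g G Q hβ hαr hr h hode hA
    have ⟨hα, hδ⟩ := constants_ne_zero hβ hαr hr
    have hρ : ((β : ℂ) * r) ^ 2 = ((β ^ 2 - 4 * α : ℝ) : ℂ) := by
      rw [hαr]; push_cast; ring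
    exact ⟨isIntegrableWith_integralTr h hα hβ hδ hρ hr.1 hode hA,
      isRationalOfDegree_integralTr h hβ hδ hr hA⟩
  · intro n hn
    obtain ⟨r, hr, hdeg⟩ := exists_admissible_degTr hn
    exact ⟨r, hr, hdeg, fun α β hβ hαr =>
      exists_setting_solution hβ (constants_ne_zero hβ hαr hr).2⟩
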